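/- Let $a_0,a_1,a_2\ge 1$ be pairwise coprime integers, let $X=\mathbb P^2(a_0,a_1,a_2)=(\mathbb C^3\setminus\{0\})/\mathbb C^*$ be the weighted projective plane over $\mathbb C$, and let $S=\mathbb C[z_0,z_1,z_2]$ be graded by $\deg z_i=a_i$. For $d\in\mathbb Z$ let $\hat\Omega^1_S(d)$ be the finite-dimensional complex vector space of 1-forms $\alpha=\sum_{i=0}^2A_i\,dz_i$ with $A_i\in S_{d-a_i}$ and $\sum_{i=0}^2a_iz_iA_i=0$. Such an $\alpha$ defines a foliation on $X$ if $\alpha\wedge d\alpha=0$ and its singular set has codimension at least $2$, that is, the ideal $\langle A_0,A_1,A_2\rangle\subset S$ has height at least $2$. A point $x\in X$ is singular for $\alpha$ if $\alpha(x)=0$, that is, $A_0,A_1,A_2$ all vanish at $x$; a singular point $x$ is a Kupka point if $d\alpha(x)\ne 0$. Both conditions are read in homogeneous coordinates, also at the singular points of $X$. Let $\ell\in\mathbb Z$ be such that $\hat\Omega^1_S(\ell+a_0+a_1+a_2)\neq 0$. Then the following are equivalent. 1. A generic $\alpha\in\hat\Omega^1_S(\ell+a_0+a_1+a_2)$ defines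 a foliation all of whose singular points are Kupka points; that is, there is a non-empty Zariski open subset $U$ of $\hat\Omega^1_S(\ell+a_0+a_1+a_2)$ such that every $\alpha\in U$ defines a foliation and has only Kupka points as singular points. 2. $\ell$ is admissible: for every $i\in\{0,1,2\}$ at least one of the congruences $\ell+a_0\equiv 0$, $\ell+a_1\equiv 0$, $\ell+a_2\equiv 0 \pmod{a_i}$ holds. -/

import Mathlib

namespace WeightedPlane

/-- `a₀, a₁, a₂` are positive and pairwise coprime. -/
def IsWeights (a : Fin 3 → ℕ) : Prop :=
  (∀ i, 0 < a i) ∧ Pairwise fun i j => Nat.Coprime (a i) (a j)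

/-- Two nonzero vectors of `ℂ³` are equivalent when they lie in the same orbit of the action
`t • (z₀, z₁, z₂) = (t ^ a₀ * z₀, t ^ a₁ * z₁, t ^ a₂ * z₂)` of `ℂˣ`. -/
def orbitSetoid (a : Fin 3 → ℕ) : Setoid {z : Fin 3 → ℂ // z ≠ 0} where
  r z w := ∃ t : ℂˣ, ∀ i, w.1 i = (t : ℂ) ^ a i * z.1 i
  iseqv :=
    { refl := fun z => ⟨1, fun i => by simp⟩
      symm := by
        rintro z w ⟨t, ht⟩
        refine ⟨t⁻¹, fun i => ?_⟩
        rw [ht i, ← mul_assoc, ← mul_pow]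
        simp
      trans := by
        rintro z w u ⟨t, ht⟩ ⟨s, hs⟩
        refine ⟨s * t, fun i => ?_⟩
        rw [hs i, ht i, ← mul_assoc, ← mul_pow]
        simp }

/-- The (closed points of the) weighted projective plane `ℙ²(a₀, a₁, a₂)` over `ℂ`. -/
def Points (a : Fin 3 → ℕ) : Type :=
  Quotient (orbitSetoid a)

/-- The point `[z₀ : z₁ : z₂]`. -/
def Points.mk (a : Fin 3 → ℕ) (z : {z : Fin 3 → ℂ // z ≠ 0}) : Points a :=
  Quotient.mk (orbitSetoid a) z

/-- Polynomial 1-forms `A 0 dz₀ + A 1 dz₁ + A 2 dz₂` on `ℂ³`, given by their coefficients. -/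
abbrev OneForm : Type :=
  Fin 3 → MvPolynomial (Fin 3) ℂ

/-- The twisted Zariski 1-forms of degree `d` on `ℙ²(a₀, a₁, a₂)` in homogeneous coordinates:
the forms `∑ A i dzᵢ` with `A i` weighted homogeneous of degree `d - a i` (so that the form is
homogeneous of degree `d`) whose contraction `∑ a i zᵢ A i` with the radial vector field
vanishes. -/
noncomputable def zariskiOneForms (a : Fin 3 → ℕ) (d : ℤ) : Submodule ℂ OneForm where
  carrier := {A | (∀ i, (A i).IsWeightedHomogeneous (fun j => (a j : ℤ)) (d - (a i : ℤ))) ∧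
    ∑ i, (a i : MvPolynomial (Fin 3) ℂ) * MvPolynomial.X i * A i = 0}
  zero_mem' := ⟨fun i => MvPolynomial.isWeightedHomogeneous_zero ℂ _ _, by simp⟩
  add_mem' := by
    rintro A B ⟨hA, hA'⟩ ⟨hB, hB'⟩
    refine ⟨fun i => (hA i).add (hB i), ?_⟩
    simp only [Pi.add_apply, mul_add, Finset.sum_add_distrib, hA', hB', add_zero]
  smul_mem' := by
    rintro c A ⟨hA, hA'⟩
    refine ⟨fun i => (MvPolynomial.weightedHomogeneousSubmodule ℂ _ _).smul_mem c (hA i), ?_⟩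
    simp only [Pi.smul_apply, mul_smul_comm, ← Finset.smul_sum, hA', smul_zero]

/-- The coefficient `∂ᵢ A j - ∂ⱼ A i` of `dzᵢ ∧ dzⱼ` in the exterior derivative of `∑ A k dzₖ`. -/
noncomputable def dCoeff (A : OneForm) (i j : Fin 3) : MvPolynomial (Fin 3) ℂ :=
  MvPolynomial.pderiv i (A j) - MvPolynomial.pderiv j (A i)

/-- The singular ideal: the ideal generated by the coefficients of the form. -/
noncomputable def singularIdeal (A : OneForm) : Ideal (MvPolynomial (Fin 3) ℂ) :=
  Ideal.span (Set.range A)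

/-- The form `∑ A i dzᵢ` is integrable (`α ∧ dα = 0`) and its singular set has codimension
at least two. -/
def IsFoliation (A : OneForm) : Prop :=
  A 0 * dCoeff A 1 2 - A 1 * dCoeff A 0 2 + A 2 * dCoeff A 0 1 = 0 ∧
    2 ≤ (singularIdeal A).height

/-- The singular set `{x : α(x) = 0}`, the vanishing being read in homogeneous coordinates. -/
def singularSet (a : Fin 3 → ℕ) (A : OneForm) : Set (Points a) :=
  {x | ∀ z, Points.mk a z = x → ∀ i, MvPolynomial.eval z.1 (A i) = 0}

/-- `x` is a Kupka point of `α`: it is singular and `dα(x) ≠ 0`, read in homogeneous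
coordinates. (For homogeneous forms neither condition depends on the representative.) -/
def IsKupkaPoint (a : Fin 3 → ℕ) (A : OneForm) (x : Points a) : Prop :=
  x ∈ singularSet a A ∧
    ∃ z, Points.mk a z = x ∧ ∃ i j, MvPolynomial.eval z.1 (dCoeff A i j) ≠ 0

/-- Zariski open subsets of a complex vector space `V` (used for finite-dimensional `V`):
complements of common zero loci of polynomial functions, these being the polynomials in the
linear functionals on `V`. -/
def IsZariskiOpen {V : Type*} [AddCommGroup V] [Module ℂ V] (U : Set V) : Prop :=
  ∃ P : Set (MvPolynomial (Module.Dual ℂ V) ℂ),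
    U = {v | ∃ f ∈ P, MvPolynomial.eval (fun φ : Module.Dual ℂ V => φ v) f ≠ 0}

/-- The degree `ℓ` is admissible for the weights `a`. -/
def Admissible (a : Fin 3 → ℕ) (ℓ : ℤ) : Prop :=
  ∀ i, ℓ + a 0 ≡ 0 [ZMOD a i] ∨ ℓ + a 1 ≡ 0 [ZMOD a i] ∨ ℓ + a 2 ≡ 0 [ZMOD a i]

end WeightedPlane

namespace WeightedPlane
open MvPolynomial

/-! Let R be the radial vector field with components a_i z_i, and d = ℓ + a_0 + a_1 + a_2. If i_R α
= 0, Euler's identity gives d·α = i_R dα (`degree_mul_coeff`), and d > 0 when α ≠ 0. So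
integrability is automatic, α vanishes wherever dα does, and all singular points are Kupka exactly
when dα, viewed as the vector field `curl` with components of degree ℓ + a_k, vanishes only at the
origin.

Necessity: a component of `curl` that is nonzero at the i-th vertex contains a pure power of z_i, so
a_i divides its degree ℓ + a_k.

Sufficiency: vanishing only at the origin is an open condition
(`exists_polynomial_of_nowhere_zero`), so one good form suffices, provided codimension at least 2
also holds generically. If α vanishes along f = 0, then dα = f·Y + g·R with deg g = ℓ
(`exists_curl_eq`). For ℓ ≠ 0, f and g both vanish at 0, so they have another common zero, where dα
vanishes. For ℓ = 0, g may be a nonzero constant; this case is excluded by an open condition on the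
linear part of dα (`radialDiscr`).

Good forms exist: for ℓ < 0 admissibility forces ℓ = -a_k and dα can be a nonzero constant; for ℓ =
0 take dα diagonal. For ℓ > 0 give all monomial forms algebraically independent coefficients. A zero
of dα with r nonzero coordinates can be rescaled to lie in a field of transcendence degree at most r
- 1, so the monomial curls there would span dimension at most r - 1 (`finrank_span_le`).
Admissibility makes them span at least r (`card_support_le_finrank`). -/

/-- The curl of a 1-form: the coefficients of its exterior derivative, cyclically ordered. -/
noncomputable def curl (A : OneForm) (k : Fin 3) : MvPolynomial (Fin 3) ℂ :=
  dCoeff A (k + 1) (k + 2)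

/-! ### Cyclic indices and Euler's identity -/

lemma dCoeff_swap (A : OneForm) (i j : Fin 3) : dCoeff A i j = -dCoeff A j i := by
  simp [dCoeff]

lemma dCoeff_self (A : OneForm) (i : Fin 3) : dCoeff A i i = 0 := by
  simp [dCoeff]

lemma sum_cyclic {M : Type*} [AddCommMonoid M] (f : Fin 3 → M) (k : Fin 3) :
    ∑ i, f i = f k + f (k + 1) + f (k + 2) := by
  fin_cases k
  · exact Fin.sum_univ_three f
  · exact (Fin.sum_univ_three f).trans (by rw [add_assoc, add_comm]; rfl)
  · exact (Fin.sum_univ_three f).trans (by rw [add_comm, ← add_assoc]; rfl)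

lemma weight_intCast (a : Fin 3 → ℕ) (m : Fin 3 →₀ ℕ) :
    Finsupp.weight (fun j => (a j : ℤ)) m = ∑ i, (m i : ℤ) * a i := by
  rw [Finsupp.weight_apply, Finsupp.sum_fintype _ _ (by simp)]
  simp

/-- Euler's identity for weighted homogeneous polynomials with an integral degree. -/
lemma euler_identity {a : Fin 3 → ℕ} {D : ℤ} {φ : MvPolynomial (Fin 3) ℂ}
    (h : φ.IsWeightedHomogeneous (fun j => (a j : ℤ)) D) :
    ∑ i, (a i : MvPolynomial (Fin 3) ℂ) * X i * pderiv i φ = (D : MvPolynomial (Fin 3) ℂ) * φ := by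
  by_cases h0 : φ = 0
  · simp [h0]
  obtain ⟨m, hm⟩ := MvPolynomial.ne_zero_iff.1 h0
  have hw : ∀ m : Fin 3 →₀ ℕ,
      Finsupp.weight (fun j => (a j : ℤ)) m = ((Finsupp.weight a m : ℕ) : ℤ) := by
    intro m
    rw [weight_intCast, Finsupp.weight_apply, Finsupp.sum_fintype _ _ (by simp)]
    simp
  have hD : D = ((Finsupp.weight a m : ℕ) : ℤ) := by rw [← h hm, hw]
  have hn : φ.IsWeightedHomogeneous a (Finsupp.weight a m) := by
    intro m' hm'
    have := h hm'
    rw [hw, hD] at this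
    exact_mod_cast this
  have := hn.sum_weight_X_mul_pderiv
  rw [hD]
  simp only [nsmul_eq_mul] at this
  simpa [mul_assoc] using this

/-! ### Radial contraction, integrability and necessity of admissibility -/

section Forms

variable {a : Fin 3 → ℕ} {d : ℤ} {A : OneForm}

lemma isWeightedHomogeneous_dCoeff
    (hA : ∀ i, (A i).IsWeightedHomogeneous (fun j => (a j : ℤ)) (d - (a i : ℤ))) (i j : Fin 3) :
    (dCoeff A i j).IsWeightedHomogeneous (fun j => (a j : ℤ)) (d - a i - a j) :=
  ((hA j).pderiv (by ring)).sub ((hA i).pderiv (by ring))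

lemma isWeightedHomogeneous_curl {ℓ : ℤ}
    (hA : ∀ i, (A i).IsWeightedHomogeneous (fun j => (a j : ℤ)) (ℓ + ∑ i, (a i : ℤ) - (a i : ℤ)))
    (k : Fin 3) : (curl A k).IsWeightedHomogeneous (fun j => (a j : ℤ)) (ℓ + a k) := by
  have := isWeightedHomogeneous_dCoeff hA (k + 1) (k + 2)
  rwa [sum_cyclic _ k, show ℓ + (a k + a (k + 1) + a (k + 2)) - a (k + 1) - a (k + 2) =
    ℓ + (a k : ℤ) by ring] at this

/-- A form annihilated by the radial vector field is, up to the factor `d`, the contraction of its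
exterior derivative with the radial vector field. -/
lemma degree_mul_coeff (hA : A ∈ zariskiOneForms a d) (i : Fin 3) :
    (d : MvPolynomial (Fin 3) ℂ) * A i =
      ∑ j, (a j : MvPolynomial (Fin 3) ℂ) * X j * dCoeff A j i := by
  have h1 := euler_identity (hA.1 i)
  have h2 := congrArg (pderiv i) hA.2
  have h3 : ∑ j, (a j : MvPolynomial (Fin 3) ℂ) * X j * pderiv i (A j) +
      (a i : MvPolynomial (Fin 3) ℂ) * A i = 0 := by
    rw [map_zero] at h2
    rw [← h2]
    fin_cases i <;> simp [Fin.sum_univ_three, pderiv_X] <;> ring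
  simp only [dCoeff, mul_sub, Finset.sum_sub_distrib]
  push_cast at h1
  linear_combination h3 - h1

/-- The degree of a nonzero weighted homogeneous polynomial is nonnegative. -/
lemma degree_nonneg {D : ℤ} {φ : MvPolynomial (Fin 3) ℂ}
    (h : φ.IsWeightedHomogeneous (fun j => (a j : ℤ)) D) (h0 : φ ≠ 0) : 0 ≤ D := by
  obtain ⟨m, hm⟩ := MvPolynomial.ne_zero_iff.1 h0
  rw [← h hm, weight_intCast]
  exact Finset.sum_nonneg fun _ _ => by positivity

lemma degree_pos (ha : IsWeights a) (hA : A ∈ zariskiOneForms a d) (h0 : A ≠ 0) : 0 < d := by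
  obtain ⟨i, hi⟩ := Function.ne_iff.1 h0
  have h := degree_nonneg (hA.1 i) hi
  have := ha.1 i
  lia

/-- The integrability condition `α ∧ dα = 0` holds for every twisted Zariski 1-form. -/
lemma integrable (hd : d ≠ 0) (hA : A ∈ zariskiOneForms a d) :
    A 0 * dCoeff A 1 2 - A 1 * dCoeff A 0 2 + A 2 * dCoeff A 0 1 = 0 := by
  have hd' : (d : MvPolynomial (Fin 3) ℂ) ≠ 0 := by exact_mod_cast hd
  apply mul_left_cancel₀ hd'
  have h0 := degree_mul_coeff hA 0
  have h1 := degree_mul_coeff hA 1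
  have h2 := degree_mul_coeff hA 2
  simp only [Fin.sum_univ_three, dCoeff_self, dCoeff_swap A 1 0, dCoeff_swap A 2 0,
    dCoeff_swap A 2 1] at h0 h1 h2
  linear_combination dCoeff A 1 2 * h0 - dCoeff A 0 2 * h1 + dCoeff A 0 1 * h2

lemma eval_curl_eq_zero_iff (A : OneForm) (z : Fin 3 → ℂ) :
    (∀ k, eval z (curl A k) = 0) ↔ ∀ i j, eval z (dCoeff A i j) = 0 := by
  refine ⟨fun h i j => ?_, fun h k => h _ _⟩
  obtain rfl | ⟨k, rfl, rfl⟩ | ⟨k, rfl, rfl⟩ :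
      i = j ∨ (∃ k, i = k + 1 ∧ j = k + 2) ∨ ∃ k, j = k + 1 ∧ i = k + 2 := by
    revert i j; decide
  · simp [dCoeff_self]
  · exact h k
  · rw [dCoeff_swap, map_neg, neg_eq_zero]; exact h k

/-- The foliations all of whose singularities are Kupka are those whose exterior derivative
vanishes only at the origin. -/
lemma kupka_of_curl (h : ∀ z : Fin 3 → ℂ, (∀ k, eval z (curl A k) = 0) → z = 0) :
    ∀ x ∈ singularSet a A, IsKupkaPoint a A x := by
  intro x hx
  obtain ⟨z, rfl⟩ := Quotient.exists_rep x
  refine ⟨hx, z, rfl, ?_⟩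
  by_contra! hz
  exact z.2 (h z.1 ((eval_curl_eq_zero_iff A z.1).2 hz))

/-- Off the singular set, d·α = i_R dα forces dα ≠ 0; on it this is the Kupka condition. -/
lemma exists_dCoeff_ne_zero (hd : d ≠ 0) (hA : A ∈ zariskiOneForms a d)
    (hK : ∀ x ∈ singularSet a A, IsKupkaPoint a A x) (x : Points a) :
    ∃ z, Points.mk a z = x ∧ ∃ i j, eval z.1 (dCoeff A i j) ≠ 0 := by
  by_cases hx : x ∈ singularSet a A
  · exact (hK x hx).2
  simp only [singularSet, Set.mem_ofPred_eq, not_forall] at hx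
  obtain ⟨z, hz, i, hi⟩ := hx
  refine ⟨z, hz, ?_⟩
  by_contra! h
  have := congrArg (eval z.1) (degree_mul_coeff hA i)
  simp [h, hi, hd] at this

/-- A weighted homogeneous polynomial not vanishing at a vertex of the coordinate triangle
involves a power of the corresponding variable. -/
lemma dvd_degree_of_eval_ne_zero {D : ℤ} {φ : MvPolynomial (Fin 3) ℂ}
    (h : φ.IsWeightedHomogeneous (fun j => (a j : ℤ)) D) {z : Fin 3 → ℂ} {i : Fin 3}
    (hz : ∀ j ≠ i, z j = 0) (hφ : eval z φ ≠ 0) : (a i : ℤ) ∣ D := by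
  rw [eval_eq'] at hφ
  obtain ⟨m, hm, hne⟩ := Finset.exists_ne_zero_of_sum_ne_zero hφ
  rw [← h (mem_support_iff.1 hm), weight_intCast, Finset.sum_eq_single i]
  · exact dvd_mul_left _ _
  · intro j _ hj
    have := Finset.prod_ne_zero_iff.1 (right_ne_zero_of_mul hne) j (Finset.mem_univ j)
    rw [hz j hj] at this
    have hm0 : m j = 0 := by
      by_contra h0
      exact this (zero_pow h0)
    simp [hm0]
  · simp

/-- Only the vertices of the coordinate triangle matter: at the i-th one some component of the curl,
of degree ℓ + a_k, is nonzero and so contains a pure power of z_i. -/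
lemma admissible_of_kupka {ℓ : ℤ} {A : OneForm} (hd : ℓ + ∑ i, (a i : ℤ) ≠ 0)
    (hA : A ∈ zariskiOneForms a (ℓ + ∑ i, (a i : ℤ)))
    (hK : ∀ x ∈ singularSet a A, IsKupkaPoint a A x) : Admissible a ℓ := by
  intro i
  let e : {z : Fin 3 → ℂ // z ≠ 0} := ⟨Pi.single i 1, by simp⟩
  obtain ⟨z, hz, hne⟩ := exists_dCoeff_ne_zero hd hA hK (Points.mk a e)
  have hk : ∃ k, eval z.1 (curl A k) ≠ 0 := by
    by_contra! h
    obtain ⟨p, q, h'⟩ := hne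
    exact h' ((eval_curl_eq_zero_iff A z.1).1 h p q)
  obtain ⟨t, ht⟩ : ∃ t : ℂˣ, ∀ i, z.1 i = (t : ℂ) ^ a i * e.1 i :=
    Quotient.exact (s := orbitSetoid a) hz.symm
  obtain ⟨k, hk⟩ := hk
  have := dvd_degree_of_eval_ne_zero (i := i) (isWeightedHomogeneous_curl hA.1 k)
    (fun j hj => by rw [ht j]; simp [e, hj]) hk
  have h0 := Int.modEq_zero_iff_dvd.2 this
  fin_cases k
  · exact Or.inl h0
  · exact Or.inr (Or.inl h0)
  · exact Or.inr (Or.inr h0)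
end Forms

/-! ### Vanishing only at the origin as an open condition -/

lemma finite_setOf_weight_eq {a : Fin 3 → ℕ} (ha : ∀ i, 0 < a i) (D : ℤ) :
    {m : Fin 3 →₀ ℕ | Finsupp.weight (fun j => (a j : ℤ)) m = D}.Finite := by
  refine (Set.finite_Iic (Finsupp.equivFunOnFinite.symm fun _ => D.toNat)).subset fun m hm i => ?_
  have h : Finsupp.weight (fun j => (a j : ℤ)) m = D := hm
  rw [weight_intCast] at h
  have h1 : (m i : ℤ) * a i ≤ D := by
    rw [← h]
    exact Finset.single_le_sum (f := fun i => (m i : ℤ) * a i) (fun _ _ => by positivity)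
      (Finset.mem_univ i)
  have h2 : (m i : ℤ) ≤ D := by
    have := ha i
    nlinarith
  simp only [Finsupp.coe_equivFunOnFinite_symm]
  lia

/-- Allows the coefficients of an ideal membership between homogeneous elements to be replaced by
homogeneous ones. -/
lemma weightedHomogeneousComponent_mul_of_right {w : Fin 3 → ℤ} {D e : ℤ}
    {p q : MvPolynomial (Fin 3) ℂ} (hq : q.IsWeightedHomogeneous w e) :
    weightedHomogeneousComponent w D (p * q) = weightedHomogeneousComponent w (D - e) p * q := by
  ext m
  rw [coeff_weightedHomogeneousComponent, coeff_mul, coeff_mul]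
  trans ∑ x ∈ Finset.HasAntidiagonal.antidiagonal m,
    if Finsupp.weight w m = D then coeff x.1 p * coeff x.2 q else 0
  · split_ifs <;> simp
  refine Finset.sum_congr rfl fun x hx => ?_
  rw [coeff_weightedHomogeneousComponent]
  by_cases h : coeff x.2 q = 0
  · simp [h]
  have h1 := hq h
  rw [← Finset.HasAntidiagonal.mem_antidiagonal.1 hx, map_add, h1]
  split_ifs <;> first | rfl | lia

lemma eval_eq_sum_weight {w : Fin 3 → ℤ} {D : ℤ} {p : MvPolynomial (Fin 3) ℂ}
    (hp : p.IsWeightedHomogeneous w D) {s : Finset (Fin 3 →₀ ℕ)}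
    (hs : ∀ m, Finsupp.weight w m = D → m ∈ s) (z : Fin 3 → ℂ) :
    eval z p = ∑ m : s, coeff m.1 p * ∏ i, z i ^ m.1 i := by
  rw [eval_eq', Finset.sum_coe_sort s (fun m => coeff m p * ∏ i, z i ^ m i)]
  refine Finset.sum_subset (fun m hm => hs m (hp (mem_support_iff.1 hm))) fun m _ hm => ?_
  simp [notMem_support_iff.1 hm]

/-- If finitely many polynomials have no common zero but the origin, all variables have a power in
the ideal which they span. -/
lemma exists_pow_mem_span {Z : Fin 3 → MvPolynomial (Fin 3) ℂ}
    (hZ : ∀ z : Fin 3 → ℂ, (∀ k, eval z (Z k) = 0) → z = 0) :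
    ∃ n : ℕ, ∀ i, (X i : MvPolynomial (Fin 3) ℂ) ^ n ∈ Ideal.span (Set.range Z) := by
  have h : ∀ i, ∃ n : ℕ, (X i : MvPolynomial (Fin 3) ℂ) ^ n ∈ Ideal.span (Set.range Z) := by
    intro i
    have : (X i : MvPolynomial (Fin 3) ℂ) ∈ (Ideal.span (Set.range Z)).radical := by
      rw [← MvPolynomial.vanishingIdeal_zeroLocus_eq_radical (K := ℂ), mem_vanishingIdeal_iff]
      intro z hz
      rw [mem_zeroLocus_iff] at hz
      have : z = 0 := hZ z fun k => by
        have := hz (Z k) (Ideal.subset_span ⟨k, rfl⟩)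
        simpa [aeval_def] using this
      simp [this]
    exact this
  choose n hn using h
  refine ⟨∑ i, n i, fun i => ?_⟩
  exact Ideal.pow_mem_of_pow_mem _ (hn i) (Finset.single_le_sum (by simp) (Finset.mem_univ i))

/-- By the Nullstellensatz some power `X i ^ n` of every variable lies in the ideal of the `Z k`,
and a monomial of large enough degree is divisible by one of these powers. Divisibility of `D` by
every weight ensures that pure powers of all variables occur in degree `D`. -/
lemma exists_coeffs {a : Fin 3 → ℕ} (ha : ∀ i, 0 < a i) {e : Fin 3 → ℤ}
    {Z : Fin 3 → MvPolynomial (Fin 3) ℂ}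
    (he : ∀ k, (Z k).IsWeightedHomogeneous (fun j => (a j : ℤ)) (e k))
    (hZ : ∀ z : Fin 3 → ℂ, (∀ k, eval z (Z k) = 0) → z = 0) :
    ∃ D : ℕ, 0 < D ∧ (∀ i, a i ∣ D) ∧ ∀ m : Fin 3 →₀ ℕ,
      Finsupp.weight (fun j => (a j : ℤ)) m = D → ∃ h : Fin 3 → MvPolynomial (Fin 3) ℂ,
        (∀ k, (h k).IsWeightedHomogeneous (fun j => (a j : ℤ)) (D - e k)) ∧
          ∑ k, h k * Z k = monomial m 1 := by
  obtain ⟨n, hn⟩ := exists_pow_mem_span hZ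
  -- If all exponents of `m` were below `n`, its weight would be at most `3 * n * ∏ a i`, which is
  -- less than `D`.
  refine ⟨3 * (n + 1) * ∏ i, a i, ?_, fun i => ?_, fun m hm => ?_⟩
  · have := Finset.prod_pos (s := Finset.univ) fun i _ => ha i
    positivity
  · exact (Finset.dvd_prod_of_mem a (Finset.mem_univ i)).mul_left _
  obtain ⟨i, hi⟩ : ∃ i, n ≤ m i := by
    by_contra! hlt
    rw [weight_intCast] at hm
    have : ∀ i ∈ Finset.univ, (m i : ℤ) * a i ≤ n * ∏ i, (a i : ℤ) := by
      intro i _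
      have h1 : a i ≤ ∏ i, a i :=
        Nat.le_of_dvd (Finset.prod_pos fun i _ => ha i)
          (Finset.dvd_prod_of_mem a (Finset.mem_univ i))
      have h2 := (hlt i).le
      calc (m i : ℤ) * a i ≤ n * (∏ i, a i : ℕ) := by exact_mod_cast Nat.mul_le_mul h2 h1
        _ = _ := by push_cast; rfl
    have h3 := Finset.sum_le_sum this
    rw [hm] at h3
    have : (0 : ℤ) < ∏ i, (a i : ℤ) := Finset.prod_pos fun i _ => by exact_mod_cast ha i
    simp at h3
    nlinarith
  have hmem : monomial m 1 ∈ Ideal.span (Set.range Z) := by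
    have : monomial m (1 : ℂ) = monomial (m - Finsupp.single i n) 1 * X i ^ n := by
      rw [X_pow_eq_monomial, monomial_mul, mul_one, tsub_add_cancel_of_le]
      simpa using hi
    rw [this]
    exact Ideal.mul_mem_left _ _ (hn i)
  obtain ⟨c, hc⟩ := Ideal.mem_span_range_iff_exists_fun.1 hmem
  refine ⟨fun k => weightedHomogeneousComponent _ _ (c k), fun k =>
    weightedHomogeneousComponent_isWeightedHomogeneous _ _, ?_⟩
  simp_rw [← weightedHomogeneousComponent_mul_of_right (he _), ← map_sum, hc]
  exact (isWeightedHomogeneous_monomial _ _ _ hm).weightedHomogeneousComponent_same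

/-- For a linear family of triples of weighted homogeneous polynomials, having no common zero but
the origin is a Zariski open condition. -/
lemma exists_polynomial_of_nowhere_zero {V : Type*} [AddCommGroup V] [Module ℂ V]
    {a : Fin 3 → ℕ} (ha : ∀ i, 0 < a i) {e : Fin 3 → ℤ}
    (Z : V →ₗ[ℂ] Fin 3 → MvPolynomial (Fin 3) ℂ)
    (he : ∀ v k, (Z v k).IsWeightedHomogeneous (fun j => (a j : ℤ)) (e k)) (v₀ : V)
    (h₀ : ∀ z : Fin 3 → ℂ, (∀ k, eval z (Z v₀ k) = 0) → z = 0) :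
    ∃ P : MvPolynomial (Module.Dual ℂ V) ℂ, eval (fun φ => φ v₀) P ≠ 0 ∧
      ∀ v, eval (fun φ : Module.Dual ℂ V => φ v) P ≠ 0 →
        ∀ z : Fin 3 → ℂ, (∀ k, eval z (Z v k) = 0) → z = 0 := by
  obtain ⟨D, hD, hdvd, hm⟩ := exists_coeffs ha (he v₀) h₀
  let s := (finite_setOf_weight_eq ha D).toFinset
  have hs : ∀ m, m ∈ s ↔ Finsupp.weight (fun j => (a j : ℤ)) m = D := fun m => by simp [s]
  have : ∀ m : s, _ := fun m => hm m.1 ((hs m.1).1 m.2)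
  choose h hh hsum using this
  -- Row `m` lists the coefficients of `∑ k, h m k * Z v k`, with `h` fixed by `v₀`. The matrix is
  -- the identity at `v₀`, and its determinant is the required polynomial.
  let φ : s → s → Module.Dual ℂ V := fun m m' =>
    lcoeff ℂ m'.1 ∘ₗ ∑ k, LinearMap.mulLeft ℂ (h m k) ∘ₗ LinearMap.proj k ∘ₗ Z
  have hφ : ∀ m m' v, φ m m' v = coeff m'.1 (∑ k, h m k * Z v k) := fun m m' v => by
    simp [φ, coeff_sum]
  have hP : ∀ v, eval (fun φ : Module.Dual ℂ V => φ v) (Matrix.of fun m m' => X (φ m m')).det =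
      (Matrix.of fun m m' => φ m m' v).det := by
    intro v
    rw [RingHom.map_det]
    congr 1
    ext m m'
    simp
  refine ⟨(Matrix.of fun m m' => X (φ m m')).det, ?_, fun v hv z hz => ?_⟩
  · rw [hP]
    convert one_ne_zero (α := ℂ)
    convert Matrix.det_one (n := s) (R := ℂ)
    ext m m'
    rw [Matrix.of_apply, hφ, hsum, coeff_monomial, Matrix.one_apply]
    by_cases hmm : m = m'
    · simp [hmm]
    · rw [if_neg hmm, if_neg fun h => hmm (Subtype.ext h)]
  · rw [hP] at hv
    -- At a common zero the vector of all monomials of degree `D` lies in the kernel, so it is zero;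
    -- its pure powers then force `z = 0`.
    have h1 : (Matrix.of fun m m' => φ m m' v).mulVec (fun m => ∏ i, z i ^ m.1 i) = 0 := by
      ext m
      simp only [Matrix.mulVec, dotProduct, Matrix.of_apply, hφ, Pi.zero_apply]
      rw [← eval_eq_sum_weight _ (fun m hm => (hs m).2 hm)]
      · simp [hz]
      · refine IsWeightedHomogeneous.sum _ _ _ fun k _ => ?_
        simpa using (hh m k).mul (he v k)
    have h2 := Matrix.eq_zero_of_mulVec_eq_zero hv h1
    ext i
    obtain ⟨n, hn⟩ := hdvd i
    have h3 := congrFun h2 ⟨Finsupp.single i n, (hs _).2 (by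
      rw [Finsupp.weight_single, hn]; simp [mul_comm])⟩
    have h4 : ∏ j, z j ^ (Finsupp.single i n j) = z i ^ n := by
      rw [Finset.prod_eq_single i] <;> simp +contextual [eq_comm]
    simp only [Pi.zero_apply] at h3
    rw [h4] at h3
    exact eq_zero_of_pow_eq_zero h3

/-! ### Koszul relations of the radial vector field -/

/-- A vector of polynomials parallel to the radial vector field is a multiple of it. -/
lemma exists_eq_mul_X {c : Fin 3 → ℂ} (hc : ∀ i, c i ≠ 0) {W : Fin 3 → MvPolynomial (Fin 3) ℂ}
    (h : ∀ i j, C (c i) * X i * W j = C (c j) * X j * W i) :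
    ∃ g, ∀ k, W k = C (c k) * X k * g := by
  have hdvd : (X 0 : MvPolynomial (Fin 3) ℂ) ∣ W 0 := by
    have h1 : (X 0 : MvPolynomial (Fin 3) ℂ) ∣ X 1 * W 0 := by
      refine ⟨C (c 1)⁻¹ * C (c 0) * W 1, ?_⟩
      have := h 0 1
      have h2 : C (c 1)⁻¹ * C (c 1) = (1 : MvPolynomial (Fin 3) ℂ) := by
        rw [← C_mul, inv_mul_cancel₀ (hc 1), C_1]
      linear_combination -C (c 1)⁻¹ * this - X 1 * W 0 * h2
    exact (X_prime.dvd_or_dvd h1).resolve_left fun h2 => by simp [X_dvd_X] at h2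
  obtain ⟨g, hg⟩ := hdvd
  have h0 : C (c 0)⁻¹ * C (c 0) = (1 : MvPolynomial (Fin 3) ℂ) := by
    rw [← C_mul, inv_mul_cancel₀ (hc 0), C_1]
  refine ⟨C (c 0)⁻¹ * g, fun k => ?_⟩
  have hne : C (c 0) * X 0 ≠ (0 : MvPolynomial (Fin 3) ℂ) :=
    mul_ne_zero (by simpa using hc 0) (X_ne_zero _)
  apply mul_left_cancel₀ hne
  rw [h 0 k, hg]
  linear_combination -C (c k) * X k * X 0 * g * h0

/-- Exactness of the Koszul complex of the radial vector field at 1-forms. -/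
lemma exists_cross_of_contract_eq_zero {c : Fin 3 → ℂ} (hc : ∀ i, c i ≠ 0)
    {B : Fin 3 → MvPolynomial (Fin 3) ℂ} (h : ∑ i, C (c i) * X i * B i = 0) :
    ∃ Y : Fin 3 → MvPolynomial (Fin 3) ℂ, ∀ k, B k =
      C (c (k + 1)) * X (k + 1) * Y (k + 2) - C (c (k + 2)) * X (k + 2) * Y (k + 1) := by
  rw [Fin.sum_univ_three] at h
  -- A pure power of `X 0` occurring in `B 0` would leave a term that the multiples of `X 1` and `X
  -- 2` cannot cancel.
  have hmem : B 0 ∈ Ideal.span (X '' {1, 2} : Set (MvPolynomial (Fin 3) ℂ)) := by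
    rw [mem_ideal_span_X_image]
    intro m hm
    by_contra! hlt
    have h1 := hlt 1 (by simp)
    have h2 := hlt 2 (by simp)
    have := congrArg (coeff (m + Finsupp.single 0 1)) h
    simp only [mul_assoc, coeff_add, coeff_C_mul, coeff_X_mul', coeff_zero] at this
    simp [h1, h2, hc 0] at this
    exact mem_support_iff.1 hm this
  rw [Set.image_pair, Ideal.mem_span_pair] at hmem
  obtain ⟨u, v, huv⟩ := hmem
  have hinv : ∀ i, C (c i)⁻¹ * C (c i) = (1 : MvPolynomial (Fin 3) ℂ) := fun i => by
    rw [← C_mul, inv_mul_cancel₀ (hc i), C_1]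
  have hdvd : (X 2 : MvPolynomial (Fin 3) ℂ) ∣ C (c 1) * B 1 + C (c 0) * X 0 * u := by
    have h1 : (X 2 : MvPolynomial (Fin 3) ℂ) ∣ X 1 * (C (c 1) * B 1 + C (c 0) * X 0 * u) := by
      refine ⟨-(C (c 2) * B 2 + C (c 0) * X 0 * v), ?_⟩
      rw [← huv] at h
      linear_combination h
    exact (X_prime.dvd_or_dvd h1).resolve_left fun h2 => by simp [X_dvd_X] at h2
  obtain ⟨w, hw⟩ := hdvd
  have hw' : C (c 2) * B 2 + C (c 0) * X 0 * v = -(X 1 * w) := by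
    apply mul_left_cancel₀ (X_ne_zero (R := ℂ) (2 : Fin 3))
    rw [← huv] at h
    linear_combination h - X 1 * hw
  refine ⟨![C (c 1)⁻¹ * C (c 2)⁻¹ * w, -C (c 2)⁻¹ * v, C (c 1)⁻¹ * u], fun k => ?_⟩
  fin_cases k
  · change B 0 = C (c 1) * X 1 * (C (c 1)⁻¹ * u) - C (c 2) * X 2 * (-C (c 2)⁻¹ * v)
    linear_combination -huv - X 1 * u * hinv 1 - X 2 * v * hinv 2
  · change B 1 = C (c 2) * X 2 * (C (c 1)⁻¹ * C (c 2)⁻¹ * w) - C (c 0) * X 0 * (C (c 1)⁻¹ * u)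
    linear_combination C (c 1)⁻¹ * hw - B 1 * hinv 1 - X 2 * C (c 1)⁻¹ * w * hinv 2
  · change B 2 = C (c 0) * X 0 * (-C (c 2)⁻¹ * v) - C (c 1) * X 1 * (C (c 1)⁻¹ * C (c 2)⁻¹ * w)
    linear_combination C (c 2)⁻¹ * hw' - B 2 * hinv 2 + X 1 * C (c 2)⁻¹ * w * hinv 1

/-! ### Heights, common zeros and divisorial components -/

/-- The maximal ideal of the origin has height three. -/
lemma three_le_height_ker_eval_zero :
    3 ≤ (RingHom.ker (eval (0 : Fin 3 → ℂ))).height := by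
  -- Kernels of setting the first `n` variables to zero: the chain 0 < (X 0) < (X 0, X 1), completed
  -- by the maximal ideal `q`.
  let p : Fin 3 → Ideal (MvPolynomial (Fin 3) ℂ) := fun n =>
    RingHom.ker (aeval fun i => if i < n then 0 else X i :
      MvPolynomial (Fin 3) ℂ →ₐ[ℂ] MvPolynomial (Fin 3) ℂ)
  have hp : ∀ n, (p n).IsPrime := fun n => RingHom.ker_isPrime _
  let q : Ideal (MvPolynomial (Fin 3) ℂ) := RingHom.ker (eval (0 : Fin 3 → ℂ))
  have hq : q.IsPrime := RingHom.ker_isPrime _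
  have hle : ∀ (n : Fin 3) (f : MvPolynomial (Fin 3) ℂ →ₐ[ℂ] MvPolynomial (Fin 3) ℂ),
      (∀ i, f (if i < n then 0 else X i) = f (X i)) → p n ≤ RingHom.ker f := by
    intro n f hf x hx
    have h : f.comp (aeval fun i => if i < n then 0 else X i) = f := by
      ext i : 1
      simpa using hf i
    have hx' : aeval (fun i => if i < n then 0 else X i) x = (0 : MvPolynomial (Fin 3) ℂ) := hx
    have := congrArg (fun g => g x) h
    simp only [AlgHom.comp_apply, hx', map_zero] at this
    exact this.symm
  have h01 : p 0 < p 1 := by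
    refine SetLike.lt_iff_le_and_exists.2 ⟨hle _ _ fun i => by simp, X 0, ?_, ?_⟩
    · simp [p, RingHom.mem_ker]
    · simp [p, RingHom.mem_ker, X_ne_zero]
  have h12 : p 1 < p 2 := by
    refine SetLike.lt_iff_le_and_exists.2 ⟨hle _ _ fun i => ?_, X 1, ?_, ?_⟩
    · fin_cases i <;> simp
    · simp [p, RingHom.mem_ker]
    · simp [p, RingHom.mem_ker, X_ne_zero]
  have h2q : p 2 < q := by
    refine SetLike.lt_iff_le_and_exists.2 ⟨fun x hx => ?_, X 2, ?_, ?_⟩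
    · have h : (eval (0 : Fin 3 → ℂ)).comp (aeval fun i => if i < 2 then 0 else X i :
          MvPolynomial (Fin 3) ℂ →ₐ[ℂ] MvPolynomial (Fin 3) ℂ).toRingHom = eval 0 := by
        ext i
        · simp
        · by_cases hi : i < 2 <;> simp [hi]
      have hx' : aeval (fun i => if i < 2 then 0 else X i) x = (0 : MvPolynomial (Fin 3) ℂ) := hx
      have := congrArg (fun g => g x) h
      simp only [RingHom.comp_apply, AlgHom.toRingHom_eq_coe, RingHom.coe_coe, hx',
        map_zero] at this
      exact this.symm
    · simp [q, RingHom.mem_ker]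
    · simp [p, RingHom.mem_ker, X_ne_zero]
  have e1 := Ideal.height_add_one_le_of_lt_of_isPrime h01
  have e2 := Ideal.height_add_one_le_of_lt_of_isPrime h12
  have e3 := Ideal.height_add_one_le_of_lt_of_isPrime h2q
  calc (3 : ℕ∞) = 0 + 1 + 1 + 1 := by norm_num
    _ ≤ (p 0).height + 1 + 1 + 1 := by gcongr; exact zero_le
    _ ≤ (p 1).height + 1 + 1 := by gcongr
    _ ≤ (p 2).height + 1 := by gcongr
    _ ≤ q.height := e3

/-- Two polynomials in three variables vanishing at the origin have another common zero. -/
lemma exists_common_zero {f g : MvPolynomial (Fin 3) ℂ} (hf : eval 0 f = 0) (hg : eval 0 g = 0) :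
    ∃ z : Fin 3 → ℂ, z ≠ 0 ∧ eval z f = 0 ∧ eval z g = 0 := by
  classical
  by_contra! h
  let m : Ideal (MvPolynomial (Fin 3) ℂ) := RingHom.ker (eval (0 : Fin 3 → ℂ))
  have hm : m.IsPrime := RingHom.ker_isPrime _
  have hle : Ideal.span (({f, g} : Finset (MvPolynomial (Fin 3) ℂ)) :
      Set (MvPolynomial (Fin 3) ℂ)) ≤ m := by
    rw [Ideal.span_le]
    intro x hx
    simp only [Finset.coe_insert, Finset.coe_singleton, Set.mem_insert_iff,
      Set.mem_singleton_iff] at hx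
    rcases hx with rfl | rfl
    · exact hf
    · exact hg
  -- If the origin were the only common zero, the Nullstellensatz would make `m` minimal over `(f,
  -- g)`, and Krull's height theorem would bound its height by 2.
  have hmin : m ∈ (Ideal.span (({f, g} : Finset (MvPolynomial (Fin 3) ℂ)) :
      Set (MvPolynomial (Fin 3) ℂ))).minimalPrimes := by
    refine ⟨⟨hm, hle⟩, fun J hJ _ x hx => ?_⟩
    have hJp := hJ.1
    rw [← IsPrime.vanishingIdeal_zeroLocus (K := ℂ) J, mem_vanishingIdeal_iff]
    intro z hz
    rw [mem_zeroLocus_iff] at hz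
    have hf' : eval z f = 0 := by simpa [aeval_def] using hz f (hJ.2 (Ideal.subset_span (by simp)))
    have hg' : eval z g = 0 := by simpa [aeval_def] using hz g (hJ.2 (Ideal.subset_span (by simp)))
    have hz0 : z = 0 := by
      by_contra hz0
      exact h z hz0 hf' hg'
    subst hz0
    have hx' : eval 0 x = 0 := hx
    simpa [aeval_def] using hx'
  have h1 := Ideal.height_le_card_of_mem_minimalPrimes_span_finset hmin
  have h2 : (({f, g} : Finset (MvPolynomial (Fin 3) ℂ)).card : ℕ∞) ≤ 2 := by
    exact_mod_cast Finset.card_le_two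
  have h3 := three_le_height_ker_eval_zero.trans (h1.trans h2)
  norm_num at h3

section
attribute [local instance] MvPolynomial.weightedGradedAlgebra

/-- A homogeneous ideal of height less than two is contained in a homogeneous principal ideal
generated by a polynomial vanishing at the origin. -/
lemma exists_principal_of_height_lt_two {a : Fin 3 → ℕ} (ha : ∀ i, 0 < a i)
    {A : OneForm} {e : Fin 3 → ℤ}
    (hA : ∀ i, (A i).IsWeightedHomogeneous (fun j => (a j : ℤ)) (e i)) (h0 : A ≠ 0)
    (hht : ¬ 2 ≤ (singularIdeal A).height) :
    ∃ f : MvPolynomial (Fin 3) ℂ, f ≠ 0 ∧ eval 0 f = 0 ∧ (∀ i, f ∣ A i) ∧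
      ∀ p D, f ∣ p → f ∣ weightedHomogeneousComponent (fun j => (a j : ℤ)) D p := by
  let 𝒜 := weightedHomogeneousSubmodule ℂ (fun j => (a j : ℤ))
  have hI : (singularIdeal A).IsHomogeneous 𝒜 := by
    apply Ideal.homogeneous_span
    rintro _ ⟨i, rfl⟩
    exact ⟨_, hA i⟩
  obtain ⟨J, hJ, hJht⟩ : ∃ J ∈ (singularIdeal A).minimalPrimes, J.height < 2 := by
    by_contra! h
    apply hht
    rw [Ideal.height_eq_inf_minimalPrimes]
    exact le_iInf₂ h
  have hJp : J.IsPrime := hJ.1.1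
  have hJh : J.IsHomogeneous 𝒜 := by
    -- The homogeneous core of `J` is a prime that still contains the homogeneous singular ideal, so
    -- by minimality it equals `J`.
    have h1 : (J.homogeneousCore 𝒜).toIdeal.IsPrime := hJp.homogeneousCore
    have h2 : singularIdeal A ≤ (J.homogeneousCore 𝒜).toIdeal := by
      rw [← hI.toIdeal_homogeneousCore_eq_self]
      exact Ideal.homogeneousCore_mono 𝒜 hJ.1.2
    have h3 := hJ.2 ⟨h1, h2⟩ (J.toIdeal_homogeneousCore_le 𝒜)
    have h4 := le_antisymm h3 (J.toIdeal_homogeneousCore_le 𝒜)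
    rw [h4]
    exact (J.homogeneousCore 𝒜).isHomogeneous
  have hJ0 : J ≠ ⊥ := by
    rintro rfl
    apply h0
    ext1 i
    exact (Ideal.mem_bot).1 (hJ.1.2 (Ideal.subset_span ⟨i, rfl⟩))
  obtain ⟨f, hfJ, hf⟩ := hJp.exists_mem_prime_of_ne_bot hJ0
  have hfp : (Ideal.span {f}).IsPrime := (Ideal.span_singleton_prime hf.ne_zero).2 hf
  -- A nonzero prime ideal of height less than 2 in a factorial ring is generated by any prime
  -- element it contains.
  have hspan : J = Ideal.span {f} := by
    by_contra hne
    have hlt : Ideal.span {f} < J :=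
      lt_of_le_of_ne ((Ideal.span_singleton_le_iff_mem _).2 hfJ) (Ne.symm hne)
    have hbot : (⊥ : Ideal (MvPolynomial (Fin 3) ℂ)) < Ideal.span {f} :=
      bot_lt_iff_ne_bot.2 fun h => hf.ne_zero (by simpa using h)
    have e1 := Ideal.height_add_one_le_of_lt_of_isPrime hbot
    have e2 := Ideal.height_add_one_le_of_lt_of_isPrime hlt
    have : (2 : ℕ∞) ≤ J.height :=
      calc (2 : ℕ∞) = 0 + 1 + 1 := by norm_num
        _ ≤ (⊥ : Ideal (MvPolynomial (Fin 3) ℂ)).height + 1 + 1 := by gcongr; exact zero_le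
        _ ≤ (Ideal.span {f}).height + 1 := by gcongr
        _ ≤ J.height := e2
    exact absurd hJht (not_lt.2 this)
  have hmem : ∀ p, p ∈ J ↔ f ∣ p := fun p => by rw [hspan, Ideal.mem_span_singleton]
  refine ⟨f, hf.ne_zero, ?_, fun i => (hmem _).1 (hJ.1.2 (Ideal.subset_span ⟨i, rfl⟩)),
    fun p D hp => (hmem _).1 (weightedHomogeneousComponent_mem_of_mem _ _ hJh ((hmem _).2 hp) D)⟩
  -- With positive weights the component of degree 0 is the constant term; if nonzero it would be a
  -- unit in the homogeneous ideal `J`.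
  by_contra hne
  have h1 := weightedHomogeneousComponent_mem_of_mem _ _ hJh hfJ 0
  have h2 : weightedHomogeneousComponent (fun j => (a j : ℤ)) 0 f = C (eval 0 f) := by
    ext m
    rw [coeff_weightedHomogeneousComponent, coeff_C]
    by_cases hm : m = 0
    · subst hm
      rw [if_pos rfl, if_pos (map_zero _), eval_zero, constantCoeff_eq]
    · rw [if_neg (Ne.symm hm), if_neg]
      obtain ⟨i, hi⟩ := Finsupp.ne_iff.1 hm
      rw [weight_intCast]
      refine (Finset.sum_pos' (fun _ _ => by positivity) ⟨i, Finset.mem_univ i, ?_⟩).ne'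
      have := ha i
      have : 0 < m i := Nat.pos_of_ne_zero hi
      positivity
  rw [h2] at h1
  exact hJp.ne_top (Ideal.eq_top_of_isUnit_mem _ h1 ((isUnit_iff_ne_zero.2 hne).map C))
end

/-! ### Codimension of the singular set -/

/-- If the singular set of a twisted Zariski 1-form contains a curve `f = 0`, then the exterior
derivative is radial along this curve. -/
lemma exists_curl_eq {a : Fin 3 → ℕ} (ha : IsWeights a) {ℓ : ℤ} {A : OneForm}
    (hA : A ∈ zariskiOneForms a (ℓ + ∑ i, (a i : ℤ))) (h0 : A ≠ 0)
    (hht : ¬ 2 ≤ (singularIdeal A).height) :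
    ∃ (f g : MvPolynomial (Fin 3) ℂ) (Y : Fin 3 → MvPolynomial (Fin 3) ℂ), eval 0 f = 0 ∧
      g.IsWeightedHomogeneous (fun j => (a j : ℤ)) ℓ ∧
        ∀ k, curl A k = f * Y k + C (a k : ℂ) * X k * g := by
  obtain ⟨f, hf0, hfe, hfA, hcomp⟩ := exists_principal_of_height_lt_two ha.1 hA.1 h0 hht
  choose B hB using hfA
  have hac : ∀ i, (a i : ℂ) ≠ 0 := fun i => by exact_mod_cast (ha.1 i).ne'
  have hBR : ∑ i, C (a i : ℂ) * X i * B i = 0 := by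
    apply mul_left_cancel₀ hf0
    have := hA.2
    simp_rw [hB] at this
    rw [mul_zero, ← this, Finset.mul_sum]
    refine Finset.sum_congr rfl fun i _ => ?_
    rw [map_natCast]
    ring
  obtain ⟨Y, hY⟩ := exists_cross_of_contract_eq_zero hac hBR
  set d := ℓ + ∑ i, (a i : ℤ) with hd
  -- As cross products, `d * A = -R × curl A` while `A = f * (R × Y)`; hence `R × W = 0`, and `W` is
  -- a multiple of `R`.
  let W : Fin 3 → MvPolynomial (Fin 3) ℂ := fun k => curl A k + d * f * Y k
  have hW : ∀ k, C (a (k + 2) : ℂ) * X (k + 2) * W (k + 1) =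
      C (a (k + 1) : ℂ) * X (k + 1) * W (k + 2) := by
    intro k
    have h1 := degree_mul_coeff hA k
    rw [sum_cyclic _ k, dCoeff_self, dCoeff_swap A (k + 1) k] at h1
    have e1 : curl A (k + 1) = dCoeff A (k + 2) k := by
      simp only [curl]; congr 1 <;> (clear * -; revert k; decide)
    have e2 : curl A (k + 2) = dCoeff A k (k + 1) := by
      simp only [curl]; congr 1 <;> (clear * -; revert k; decide)
    simp only [W, e1, e2]
    have h2 := hY k
    rw [hB k, h2] at h1
    simp only [map_natCast] at h1 ⊢
    linear_combination -h1
  have hW' : ∀ i j, C (a i : ℂ) * X i * W j = C (a j : ℂ) * X j * W i := by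
    intro i j
    obtain rfl | ⟨k, rfl, rfl⟩ | ⟨k, rfl, rfl⟩ :
        i = j ∨ (∃ k, i = k + 2 ∧ j = k + 1) ∨ ∃ k, j = k + 2 ∧ i = k + 1 := by
      revert i j; decide
    · rfl
    · exact hW k
    · exact (hW k).symm
  obtain ⟨g, hg⟩ := exists_eq_mul_X hac hW'
  -- Divisibility by `f` passes to homogeneous components, so `g` may be replaced by its part of
  -- degree `ℓ`.
  have hdvd : ∀ k, f ∣ curl A k - C (a k : ℂ) * X k *
      weightedHomogeneousComponent (fun j => (a j : ℤ)) ℓ g := by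
    intro k
    have h1 : f ∣ curl A k - g * (C (a k : ℂ) * X k) := by
      refine ⟨-(d * Y k), ?_⟩
      have := hg k
      simp only [W] at this
      linear_combination this
    have hX : (C (a k : ℂ) * X k : MvPolynomial (Fin 3) ℂ).IsWeightedHomogeneous
        (fun j => (a j : ℤ)) (a k) := (isWeightedHomogeneous_X _ _ _).C_mul _
    have h2 := hcomp _ (ℓ + a k) h1
    rw [map_sub, weightedHomogeneousComponent_mul_of_right hX, add_sub_cancel_right,
      (isWeightedHomogeneous_curl hA.1 k).weightedHomogeneousComponent_same] at h2
    rwa [mul_comm (C (a k : ℂ) * X k)]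
  choose Y' hY' using hdvd
  exact ⟨f, _, Y', hfe, weightedHomogeneousComponent_isWeightedHomogeneous _ _,
    fun k => by rw [← hY']; ring⟩

/-- In nonzero degree the singular set has codimension two as soon as the exterior derivative
vanishes only at the origin. -/
lemma two_le_height_of_curl {a : Fin 3 → ℕ} (ha : IsWeights a) {ℓ : ℤ} (hℓ : ℓ ≠ 0) {A : OneForm}
    (hA : A ∈ zariskiOneForms a (ℓ + ∑ i, (a i : ℤ))) (h0 : A ≠ 0)
    (h : ∀ z : Fin 3 → ℂ, (∀ k, eval z (curl A k) = 0) → z = 0) :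
    2 ≤ (singularIdeal A).height := by
  by_contra hht
  obtain ⟨f, g, Y, hf, hg, hfg⟩ := exists_curl_eq ha hA h0 hht
  -- A nonzero constant term has weight 0, which would force `ℓ = 0`.
  have hg0 : eval 0 g = 0 := by
    by_contra hne
    rw [eval_zero, constantCoeff_eq] at hne
    have := hg hne
    rw [map_zero] at this
    exact hℓ this.symm
  obtain ⟨z, hz, hzf, hzg⟩ := exists_common_zero hf hg0
  exact hz (h z fun k => by rw [hfg]; simp [hzf, hzg])

/-- A polynomial in the entries of a `3 × 3` matrix which vanishes on the perturbations of rank one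
of the multiples of the diagonal matrix with inverse entries `b`. -/
def radialDiscr {R : Type*} [CommRing R] (b : Fin 3 → R) (M : Fin 3 → Fin 3 → R) : R :=
  (b 0 * b 1 * (M 0 0 * M 1 1 - M 0 1 * M 1 0) - b 0 * b 2 * (M 0 0 * M 2 2 - M 0 2 * M 2 0)) *
      (b 0 * M 0 0 - b 2 * M 2 2) -
    (b 0 * b 1 * (M 0 0 * M 1 1 - M 0 1 * M 1 0) - b 1 * b 2 * (M 1 1 * M 2 2 - M 1 2 * M 2 1)) *
      (b 1 * M 1 1 - b 2 * M 2 2)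

lemma map_radialDiscr {R S : Type*} [CommRing R] [CommRing S] (φ : R →+* S) (b : Fin 3 → R)
    (M : Fin 3 → Fin 3 → R) :
    φ (radialDiscr b M) = radialDiscr (fun i => φ (b i)) fun i j => φ (M i j) := by
  simp [radialDiscr]

/-- Put u_i = y_i f_i / a_i. After dividing row i by a_i, the diagonal entries are g + u_i and the
principal 2 × 2 minors g² + g(u_i + u_j). Both products in the discriminant become g(u_0 - u_2)(u_1
- u_2). -/
lemma radialDiscr_eq_zero {K : Type*} [Field K] {a : Fin 3 → K} (ha : ∀ i, a i ≠ 0) (g : K)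
    (y f : Fin 3 → K) :
    radialDiscr (fun i => (a i)⁻¹) (fun i j => y i * f j + if i = j then a i * g else 0) = 0 := by
  have h0 := ha 0
  have h1 := ha 1
  have h2 := ha 2
  simp only [radialDiscr]
  simp
  field_simp
  ring

/-- The linear part at the origin of the exterior derivative, seen as a vector field. -/
noncomputable def linearPart (A : OneForm) (i j : Fin 3) : ℂ :=
  eval 0 (pderiv j (curl A i))

/-- If dα = f·Y + g·R with f(0) = 0, its linear part at the origin is Y(0) ⊗ df(0) + g(0)·diag(a),
where the discriminant vanishes. This serves degree ℓ = 0, where g may be a nonzero constant. -/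
lemma two_le_height_of_radialDiscr {a : Fin 3 → ℕ} (ha : IsWeights a) {A : OneForm} {ℓ : ℤ}
    (hA : A ∈ zariskiOneForms a (ℓ + ∑ i, (a i : ℤ))) (h0 : A ≠ 0)
    (h : radialDiscr (fun i => ((a i : ℂ))⁻¹) (linearPart A) ≠ 0) :
    2 ≤ (singularIdeal A).height := by
  by_contra hht
  obtain ⟨f, g, Y, hf, -, hfg⟩ := exists_curl_eq ha hA h0 hht
  rw [eval_zero] at hf
  have hac : ∀ i, (a i : ℂ) ≠ 0 := fun i => by exact_mod_cast (ha.1 i).ne'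
  apply h
  rw [← radialDiscr_eq_zero hac (eval 0 g) (fun i => eval 0 (Y i)) fun j => eval 0 (pderiv j f)]
  congr 1
  ext i j
  rw [show linearPart A i j = eval 0 (pderiv j (curl A i)) from rfl, hfg]
  by_cases hij : i = j
  · subst hij
    simp [hf]
    ring
  · simp [hf, hij]

/-! ### From one good form to the generic form -/

/-- The curl as a linear map. -/
noncomputable def curlₗ : OneForm →ₗ[ℂ] Fin 3 → MvPolynomial (Fin 3) ℂ where
  toFun := curl
  map_add' A B := by
    ext1 k
    simp only [curl, dCoeff, Pi.add_apply, map_add]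
    ring
  map_smul' c A := by
    ext1 k
    simp only [curl, dCoeff, Pi.smul_apply, Derivation.map_smul, RingHom.id_apply, smul_sub]

lemma curlₗ_apply (A : OneForm) : curlₗ A = curl A := rfl

/-- Given one form whose exterior derivative vanishes only at the origin, with an additional
condition in degree zero, the generic form is a foliation with only Kupka singularities. -/
lemma exists_zariski_open {a : Fin 3 → ℕ} (ha : IsWeights a) {ℓ : ℤ}
    (hd : ℓ + ∑ i, (a i : ℤ) ≠ 0) {A₀ : OneForm}
    (hA₀ : A₀ ∈ zariskiOneForms a (ℓ + ∑ i, (a i : ℤ)))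
    (h₀ : ∀ z : Fin 3 → ℂ, (∀ k, eval z (curl A₀ k) = 0) → z = 0)
    (hdisc : ℓ = 0 → radialDiscr (fun i => ((a i : ℂ))⁻¹) (linearPart A₀) ≠ 0) :
    ∃ U : Set (zariskiOneForms a (ℓ + ∑ i, (a i : ℤ))),
      IsZariskiOpen U ∧ U.Nonempty ∧
        ∀ α ∈ U, IsFoliation α.1 ∧ ∀ x ∈ singularSet a α.1, IsKupkaPoint a α.1 x := by
  set V := zariskiOneForms a (ℓ + ∑ i, (a i : ℤ)) with hV
  obtain ⟨P, hP₀, hP⟩ := exists_polynomial_of_nowhere_zero ha.1 (e := fun k => ℓ + a k)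
    (curlₗ ∘ₗ V.subtype) (fun v k => isWeightedHomogeneous_curl v.2.1 k) ⟨A₀, hA₀⟩ h₀
  let φ : Fin 3 → Fin 3 → Module.Dual ℂ V := fun i j =>
    (aeval (0 : Fin 3 → ℂ)).toLinearMap ∘ₗ (pderiv j).toLinearMap ∘ₗ LinearMap.proj i ∘ₗ
      curlₗ ∘ₗ V.subtype
  have hφ : ∀ i j (v : V), φ i j v = linearPart v.1 i j := by
    intro i j v
    simp [φ, linearPart, curlₗ_apply]
  -- The discriminant is imposed only for `ℓ = 0`; in the other degrees the condition on the curl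
  -- already gives codimension two.
  let Q : MvPolynomial (Module.Dual ℂ V) ℂ :=
    if ℓ = 0 then radialDiscr (fun i => C ((a i : ℂ))⁻¹) (fun i j => X (φ i j)) else 1
  have hQ : ℓ = 0 → ∀ v : V, eval (fun φ : Module.Dual ℂ V => φ v) Q =
      radialDiscr (fun i => ((a i : ℂ))⁻¹) (linearPart v.1) := by
    intro hℓ v
    simp only [Q, if_pos hℓ, map_radialDiscr, eval_C, eval_X, hφ]
  refine ⟨{v | ∃ f ∈ ({P * Q} : Set _), eval (fun φ : Module.Dual ℂ V => φ v) f ≠ 0},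
    ⟨_, rfl⟩, ⟨⟨A₀, hA₀⟩, P * Q, rfl, ?_⟩, ?_⟩
  · rw [map_mul]
    refine mul_ne_zero hP₀ ?_
    by_cases hℓ : ℓ = 0
    · rw [hQ hℓ]
      exact hdisc hℓ
    · simp [Q, hℓ]
  · rintro α ⟨f, hf, hα⟩
    obtain rfl : f = P * Q := hf
    rw [map_mul] at hα
    have hα1 : ∀ z : Fin 3 → ℂ, (∀ k, eval z (curl α.1 k) = 0) → z = 0 :=
      hP α (left_ne_zero_of_mul hα)
    have hα0 : α.1 ≠ 0 := by
      intro h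
      have := hα1 1 fun k => by simp [h, curl, dCoeff]
      exact one_ne_zero this
    refine ⟨⟨integrable hd α.2, ?_⟩, kupka_of_curl hα1⟩
    by_cases hℓ : ℓ = 0
    · refine two_le_height_of_radialDiscr ha α.2 hα0 ?_
      rw [← hQ hℓ]
      exact right_ne_zero_of_mul hα
    · exact two_le_height_of_curl ha hℓ α.2 hα0 hα1

/-! ### Prescribing the curl, and forms of degree ℓ ≤ 0 -/

lemma curl_pderiv (p : MvPolynomial (Fin 3) ℂ) (k : Fin 3) : curl (fun i => pderiv i p) k = 0 := by
  simp only [curl, dCoeff]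
  have : ∀ i j : Fin 3, pderiv i (pderiv j p) = pderiv j (pderiv i p) := fun i j => by
    -- A commutator of derivations is a derivation, so it suffices that it kills the variables.
    have h : ⁅(pderiv i : Derivation ℂ (MvPolynomial (Fin 3) ℂ) (MvPolynomial (Fin 3) ℂ)),
        (pderiv j : Derivation ℂ (MvPolynomial (Fin 3) ℂ) (MvPolynomial (Fin 3) ℂ))⁆ = 0 := by
      apply MvPolynomial.derivation_ext
      intro k
      simp [Derivation.commutator_apply, pderiv_X, Pi.single_apply, apply_ite]
    have := congrArg (fun D => D p) h
    simpa [Derivation.commutator_apply, sub_eq_zero] using this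
  rw [this, sub_self]

/-- The contraction of the exterior derivative of a homogeneous form with the radial vector field
is a twisted Zariski 1-form with proportional exterior derivative. -/
lemma exists_curl_eq_mul {a : Fin 3 → ℕ} {d : ℤ} {B : OneForm}
    (hB : ∀ i, (B i).IsWeightedHomogeneous (fun j => (a j : ℤ)) (d - (a i : ℤ))) :
    ∃ A ∈ zariskiOneForms a d, ∀ k, curl A k = C (d : ℂ) * curl B k := by
  let p : MvPolynomial (Fin 3) ℂ := ∑ j, (a j : MvPolynomial (Fin 3) ℂ) * X j * B j
  have hp : p.IsWeightedHomogeneous (fun j => (a j : ℤ)) d := by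
    refine IsWeightedHomogeneous.sum _ _ _ fun j _ => ?_
    have h1 : ((a j : MvPolynomial (Fin 3) ℂ) * X j).IsWeightedHomogeneous
        (fun j => (a j : ℤ)) (a j : ℤ) := by
      rw [← map_natCast (C : ℂ →+* MvPolynomial (Fin 3) ℂ)]
      exact (isWeightedHomogeneous_X _ _ _).C_mul _
    simpa using h1.mul (hB j)
  have hAB : (fun i => C (d : ℂ) * B i - pderiv i p : OneForm) =
      (d : ℂ) • B - fun i => pderiv i p := by
    ext1 i
    simp [smul_eq_C_mul]
  -- Cartan's formula: i_R dB = d·B - d(i_R B), with `p = i_R B`; the exact term does not affect the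
  -- curl.
  refine ⟨fun i => C (d : ℂ) * B i - pderiv i p,
    ⟨fun i => ((hB i).C_mul _).sub (hp.pderiv (by ring)), ?_⟩, fun k => ?_⟩
  · have h1 := euler_identity hp
    simp only [mul_sub, Finset.sum_sub_distrib, h1, p, Finset.mul_sum, map_intCast]
    rw [sub_eq_zero]
    exact Finset.sum_congr rfl fun i _ => by ring
  · rw [hAB, ← curlₗ_apply, map_sub, map_smul, Pi.sub_apply, curlₗ_apply, curlₗ_apply,
      curl_pderiv, sub_zero, Pi.smul_apply, smul_eq_C_mul]

/-- A nonzero space of twisted Zariski 1-forms of admissible negative degree contains forms with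
constant exterior derivative. -/
lemma exists_eq_neg_of_admissible {a : Fin 3 → ℕ} (ha : IsWeights a) {ℓ : ℤ} (hℓ : ℓ < 0)
    (hne : zariskiOneForms a (ℓ + ∑ i, (a i : ℤ)) ≠ ⊥) (h : Admissible a ℓ) :
    ∃ k, ℓ = -a k := by
  obtain ⟨A, hA, hA0⟩ := (Submodule.ne_bot_iff _).1 hne
  obtain ⟨k, hk⟩ : ∃ k, curl A k ≠ 0 := by
    by_contra! hc
    apply hA0
    ext1 i
    have h1 := degree_mul_coeff hA i
    have h2 : ∀ j, dCoeff A j i = 0 := fun j => by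
      obtain rfl | ⟨k, rfl, rfl⟩ | ⟨k, rfl, rfl⟩ :
          i = j ∨ (∃ k, i = k + 1 ∧ j = k + 2) ∨ ∃ k, j = k + 1 ∧ i = k + 2 := by
        clear * -; revert i j; decide
      · exact dCoeff_self _ _
      · rw [dCoeff_swap, neg_eq_zero]; exact hc k
      · exact hc k
    simp only [h2, mul_zero, Finset.sum_const_zero] at h1
    exact (mul_eq_zero.1 h1).resolve_left (by exact_mod_cast (degree_pos ha hA hA0).ne')
  have hk' := degree_nonneg (isWeightedHomogeneous_curl hA.1 k) hk
  -- For the largest weight a_i, the bounds -a_k ≤ ℓ < 0 give |ℓ + a_j| < a_i, so the congruence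
  -- modulo a_i becomes an equality.
  obtain ⟨i, -, hi⟩ := Finset.exists_max_image Finset.univ a ⟨0, Finset.mem_univ 0⟩
  have key : ∀ j, ℓ + a j ≡ 0 [ZMOD a i] → ℓ = -a j := by
    intro j hj
    have h1 := hi j (Finset.mem_univ j)
    have h2 := hi k (Finset.mem_univ k)
    have h3 := ha.1 j
    have := Int.eq_zero_of_abs_lt_dvd (Int.modEq_zero_iff_dvd.1 hj) (by rw [abs_lt]; lia)
    lia
  rcases h i with h | h | h
  exacts [⟨0, key 0 h⟩, ⟨1, key 1 h⟩, ⟨2, key 2 h⟩]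

/-- The form z_{k+1} dz_{k+2} has the right degree and a nonzero constant derivative. -/
lemma exists_curl_ne_zero_of_eq_neg {a : Fin 3 → ℕ} {ℓ : ℤ} {k : Fin 3} (hℓ : ℓ = -a k) :
    ∃ B : OneForm, (∀ i, (B i).IsWeightedHomogeneous (fun j => (a j : ℤ))
      (ℓ + ∑ i, (a i : ℤ) - a i)) ∧ ∀ z : Fin 3 → ℂ, (∀ k, eval z (curl B k) = 0) → z = 0 := by
  refine ⟨Pi.single (k + 2) (X (k + 1)), fun i => ?_, fun z hz => ?_⟩
  · by_cases hi : i = k + 2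
    · subst hi
      rw [Pi.single_eq_same, sum_cyclic _ k, hℓ]
      convert isWeightedHomogeneous_X ℂ (fun j => (a j : ℤ)) (k + 1) using 1
      ring
    · rw [Pi.single_eq_of_ne hi]
      exact isWeightedHomogeneous_zero _ _ _
  · have h1 : k + 1 ≠ k + 2 := by clear * -; revert k; decide
    have := hz k
    simp [curl, dCoeff, h1] at this

/-- The forms ∑ c_k z_{k+1} z_{k+2} dz_k realise diagonal linear curls, the entries summing to zero
because a curl has no divergence. -/
lemma exists_curl_eq_diagonal (a : Fin 3 → ℕ) (c : Fin 3 → ℂ) :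
    ∃ B : OneForm, (∀ i, (B i).IsWeightedHomogeneous (fun j => (a j : ℤ))
      (0 + ∑ i, (a i : ℤ) - a i)) ∧ ∀ k, curl B k = C (c (k + 2) - c (k + 1)) * X k := by
  refine ⟨fun k => C (c k) * (X (k + 1) * X (k + 2)), fun i => ?_, fun k => ?_⟩
  · apply IsWeightedHomogeneous.C_mul
    convert (isWeightedHomogeneous_X ℂ (fun j => (a j : ℤ)) (i + 1)).mul
      (isWeightedHomogeneous_X ℂ (fun j => (a j : ℤ)) (i + 2)) using 1
    rw [sum_cyclic _ i]
    ring
  · have e1 : k + 1 + 1 = k + 2 := by clear * -; revert k; decide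
    have e2 : k + 1 + 2 = k := by clear * -; revert k; decide
    have e3 : k + 2 + 1 = k := by clear * -; revert k; decide
    have e4 : k + 2 + 2 = k + 1 := by clear * -; revert k; decide
    have n1 : k + 1 ≠ k := by clear * -; revert k; decide
    have n2 : k + 2 ≠ k := by clear * -; revert k; decide
    simp only [curl, dCoeff, e1, e2, e3, e4]
    simp [pderiv_X_of_ne n1.symm, pderiv_X_of_ne n2.symm]
    ring

/-! ### Numerical semigroups generated by two weights -/

lemma exists_add_mul_eq {p q : ℕ} (hp : 0 < p) (hq : 0 < q) (hpq : Nat.Coprime p q) {n : ℤ}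
    (hn : ((p : ℤ) - 1) * (q - 1) ≤ n) : ∃ u v : ℕ, (u : ℤ) * p + v * q = n := by
  obtain ⟨x, y, hxy⟩ := Nat.isCoprime_iff_coprime.2 hpq
  have hq' : (0 : ℤ) < q := by exact_mod_cast hq
  have h1 := Int.emod_nonneg (n * x) hq'.ne'
  have h2 := Int.emod_lt_of_pos (n * x) hq'
  have h3 := Int.emod_add_mul_ediv (n * x) q
  have h4 : n * x % q * p + (n * y + p * (n * x / q)) * q = n := by
    linear_combination n * hxy + p * h3
  -- The coefficient of `p` is at most `q - 1`, so a negative coefficient of `q` would give `n ≤ (q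
  -- - 1) * p - q`, just below the bound.
  have h5 : 0 ≤ n * y + p * (n * x / q) := by
    by_contra! hlt
    have : (0 : ℤ) < p := by exact_mod_cast hp
    nlinarith
  lift n * x % q to ℕ using h1 with u
  lift n * y + p * (n * x / q) to ℕ using h5 with v
  exact ⟨u, v, h4⟩

/-- Write ℓ + r = pqn with n > 0. Then r divides ℓ + p + r = p(qn + 1), hence qn + 1, so r ≤ qn + 1
and ℓ ≥ (p - 1)qn - 1. This reaches the bound (p - 1)(q - 1) if p ≥ 2; the case p = 1 is trivial. -/
lemma exists_add_mul_eq_of_dvd_add {p q r : ℕ} (hp : 0 < p) (hq : 0 < q) (hpq : Nat.Coprime p q)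
    (hrp : Nat.Coprime r p) {ℓ : ℤ} (hℓ : 0 < ℓ)
    (h1 : (p : ℤ) ∣ ℓ + r) (h2 : (q : ℤ) ∣ ℓ + r) (h : (r : ℤ) ∣ ℓ + p) :
    ∃ u v : ℕ, (u : ℤ) * p + v * q = ℓ := by
  obtain ⟨n, hn⟩ := (Nat.isCoprime_iff_coprime.2 hpq).mul_dvd h1 h2
  have hp' : (0 : ℤ) < p := by exact_mod_cast hp
  have hq' : (0 : ℤ) < q := by exact_mod_cast hq
  have hn0 : 0 < n := by
    have : 0 < (p : ℤ) * q * n := by rw [← hn]; positivity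
    exact pos_of_mul_pos_right this (by positivity)
  have hdvd : (r : ℤ) ∣ p * (q * n + 1) := by
    have := h.add (dvd_refl (r : ℤ))
    rwa [show ℓ + p + r = p * (q * n + 1) by linear_combination hn] at this
  have hr := Int.le_of_dvd (by positivity)
    ((Nat.isCoprime_iff_coprime.2 hrp).dvd_of_dvd_mul_left hdvd)
  refine exists_add_mul_eq hp hq hpq ?_
  obtain h | h : (p : ℤ) = 1 ∨ 2 ≤ (p : ℤ) := by lia
  · rw [h]; lia
  · have : ((p : ℤ) - 1) * q * 1 ≤ (p - 1) * q * n := by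
      apply mul_le_mul_of_nonneg_left (by lia)
      have : (0 : ℤ) ≤ p - 1 := by lia
      positivity
    linarith

/-- The semigroup of two of the weights contains an admissible degree in the critical case. -/
lemma exists_add_mul_eq_of_dvd {p q r : ℕ} (hp : 0 < p) (hq : 0 < q) (hr : 0 < r)
    (hpq : Nat.Coprime p q) (hrp : Nat.Coprime r p) (hrq : Nat.Coprime r q) {ℓ : ℤ} (hℓ : 0 < ℓ)
    (h1 : (p : ℤ) ∣ ℓ + r) (h2 : (q : ℤ) ∣ ℓ + r)
    (h : (r : ℤ) ∣ ℓ + p ∨ (r : ℤ) ∣ ℓ + q ∨ (r : ℤ) ∣ ℓ) :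
    ∃ u v : ℕ, (u : ℤ) * p + v * q = ℓ := by
  rcases h with h | h | h
  · exact exists_add_mul_eq_of_dvd_add hp hq hpq hrp hℓ h1 h2 h
  · obtain ⟨u, v, huv⟩ := exists_add_mul_eq_of_dvd_add hq hp hpq.symm hrq hℓ h2 h1 h
    exact ⟨v, u, by rw [← huv]; ring⟩
  · obtain ⟨n, hn⟩ := (Nat.isCoprime_iff_coprime.2 hpq).mul_dvd h1 h2
    have hp' : (0 : ℤ) < p := by exact_mod_cast hp
    have hq' : (0 : ℤ) < q := by exact_mod_cast hq
    have hn0 : 0 < n := by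
      have : 0 < (p : ℤ) * q * n := by rw [← hn]; positivity
      exact pos_of_mul_pos_right this (by positivity)
    -- Here `r` divides `n`, so `r ≤ n` and `ℓ ≥ (p * q - 1) * n`, again beyond the bound.
    have hdvd : (r : ℤ) ∣ p * q * n := by
      rw [← hn]
      exact h.add (dvd_refl _)
    have hrn := Int.le_of_dvd hn0 (IsCoprime.dvd_of_dvd_mul_left
      ((Nat.isCoprime_iff_coprime.2 hrp).mul_right (Nat.isCoprime_iff_coprime.2 hrq)) hdvd)
    refine exists_add_mul_eq hp hq hpq ?_
    have h3 : ((p : ℤ) * q - 1) * 1 ≤ (p * q - 1) * n := by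
      apply mul_le_mul_of_nonneg_left (by lia)
      have : (1 : ℤ) ≤ p * q := by nlinarith
      lia
    linarith

/-! ### Linear relations with algebraically independent coefficients -/

/-- There are arbitrarily large finite families of complex numbers which are algebraically
independent over the rationals. -/
lemma exists_algebraicIndependent (J : Type) [Finite J] :
    ∃ c : J → ℂ, AlgebraicIndependent ℚ c := by
  obtain ⟨s, hs⟩ := exists_isTranscendenceBasis ℚ ℂ
  have h1 : Cardinal.mk ℂ = Cardinal.mk s :=
    IsAlgClosed.cardinal_eq_cardinal_transcendence_basis_of_aleph0_lt' _ hs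
      (by simp) (by rw [Cardinal.mk_complex]; exact Cardinal.aleph0_lt_continuum)
  have h2 : Infinite s := by
    rw [Cardinal.infinite_iff, ← h1, Cardinal.mk_complex]
    exact Cardinal.aleph0_le_continuum
  obtain ⟨n, ⟨e⟩⟩ := Finite.exists_equiv_fin J
  let f := (Infinite.natEmbedding s)
  exact ⟨_, hs.1.comp (fun j => f (e j)) fun i j h => e.injective (Fin.ext (f.injective h))⟩

/-- Algebraically independent numbers are not contained in a field generated by fewer numbers. -/
lemma encard_le_of_forall_mem_adjoin {J : Type*} {c : J → ℂ} (hc : AlgebraicIndependent ℚ c)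
    {s : Set ℂ} (hs : ∀ j, c j ∈ IntermediateField.adjoin ℚ s) : ENat.card J ≤ s.encard := by
  have halg : ∀ x ∈ IntermediateField.adjoin ℚ s, IsAlgebraic (Algebra.adjoin ℚ s) x := by
    intro x hx
    induction hx using IntermediateField.adjoin_induction with
    | mem x hx => exact isAlgebraic_algebraMap (⟨x, Algebra.subset_adjoin hx⟩ : Algebra.adjoin ℚ s)
    | algebraMap x =>
      exact isAlgebraic_algebraMap (algebraMap ℚ (Algebra.adjoin ℚ s) x)
    | add x y _ _ hx hy => exact hx.add hy
    | inv x _ hx => exact hx.inv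
    | mul x y _ _ hx hy => exact hx.mul hy
  let M := AlgebraicIndependent.matroid ℚ ℂ
  have h1 : M.Indep (Set.range c) := hc.to_subtype_range
  have h2 : Set.range c ⊆ M.closure s := by
    rw [AlgebraicIndependent.matroid_closure_eq]
    rintro _ ⟨j, rfl⟩
    exact halg _ (hs j)
  calc ENat.card J = (Set.range c).encard := by
        rw [← Set.image_univ, hc.injective.encard_image, Set.encard_univ]
    _ ≤ M.eRk (M.closure s) := h1.encard_le_eRk_of_subset h2
    _ = M.eRk s := M.eRk_closure_eq s
    _ ≤ s.encard := M.eRk_le_encard s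

/-- A linear relation with algebraically independent coefficients between vectors with coordinates
in a field of transcendence degree less than the rank of these vectors is impossible. -/
lemma finrank_span_le {J : Type} [Fintype J] {n : Type} [Fintype n] [DecidableEq n] {c : J → ℂ}
    (hc : AlgebraicIndependent ℚ c) {s : Finset ℂ}
    {K : IntermediateField ℚ ℂ} (hK : K = IntermediateField.adjoin ℚ (s : Set ℂ)) (v : J → n → K)
    (h : ∀ k, ∑ j, c j * (v j k : ℂ) = 0) :
    Module.finrank K (Submodule.span K (Set.range v)) ≤ s.card := by
  classical
  obtain ⟨κ, b, hb, hspan, hli⟩ := exists_linearIndependent' K v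
  have : Finite κ := Finite.of_injective b hb
  have := Fintype.ofFinite κ
  rw [← hspan, finrank_span_eq_card hli]
  -- The generators of `K` together with the `c j` outside a basis `v ∘ b`. If these generate every
  -- `c j`, counting gives `|J| ≤ |s| + |J| - |κ|`.
  let S : Set ℂ := s ∪ c '' (Set.range b)ᶜ
  have hKS : K ≤ IntermediateField.adjoin ℚ S :=
    hK ▸ IntermediateField.adjoin.mono _ _ _ Set.subset_union_left
  have hS : ∀ j, c j ∈ IntermediateField.adjoin ℚ S := by
    have hout : ∀ j ∉ Set.range b, c j ∈ IntermediateField.adjoin ℚ S := fun j hj =>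
      IntermediateField.subset_adjoin _ _ (Or.inr ⟨j, hj, rfl⟩)
    intro j
    by_cases hj : j ∈ Set.range b
    swap
    · exact hout j hj
    obtain ⟨i, rfl⟩ := hj
    -- Applying to the relation a functional dual to the basis vector `v (b i)` solves for `c (b i)`
    -- in terms of the `c j` outside the basis.
    obtain ⟨φ, hφ⟩ : ∃ φ : (n → K) →ₗ[K] K,
        φ ∘ₗ (Submodule.span K (Set.range (v ∘ b))).subtype = Finsupp.lapply i ∘ₗ hli.repr :=
      LinearMap.exists_extend _
    have hφi : ∀ i', φ (v (b i')) = if i' = i then 1 else 0 := by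
      intro i'
      have h1 := congrArg (fun ψ => ψ (⟨v (b i'), Submodule.subset_span ⟨i', rfl⟩⟩ :
        Submodule.span K (Set.range (v ∘ b)))) hφ
      simp only [LinearMap.comp_apply, Submodule.subtype_apply] at h1
      rw [h1]
      have h2 := hli.repr_eq_single i' ⟨v (b i'), Submodule.subset_span ⟨i', rfl⟩⟩ rfl
      simp only [h2, Finsupp.lapply_apply, Finsupp.single_apply]
    have hsum : ∑ j, c j * ((φ (v j) : K) : ℂ) = 0 := by
      have h1 : ∀ j, φ (v j) = ∑ k, v j k * φ (Pi.single k 1) := by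
        intro j
        conv_lhs => rw [LinearMap.pi_apply_eq_sum_univ φ (v j)]
        refine Finset.sum_congr rfl fun k _ => ?_
        rw [smul_eq_mul]
        congr 2
        ext k'
        simp [Pi.single_apply, eq_comm]
      have h2 : ∑ k, (∑ j, c j * (v j k : ℂ)) * ((φ (Pi.single k 1) : K) : ℂ) = 0 := by
        simp [h]
      rw [← h2]
      simp_rw [h1, Finset.sum_mul]
      rw [Finset.sum_comm]
      refine Finset.sum_congr rfl fun j _ => ?_
      push_cast
      rw [Finset.mul_sum]
      exact Finset.sum_congr rfl fun k _ => by ring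
    rw [← Finset.add_sum_erase _ _ (Finset.mem_univ (b i)), hφi, if_pos rfl] at hsum
    have h3 : c (b i) = -∑ j ∈ Finset.univ.erase (b i), c j * ((φ (v j) : K) : ℂ) := by
      rw [eq_neg_iff_add_eq_zero, ← hsum]
      simp
    rw [h3]
    refine neg_mem (sum_mem fun j hj => ?_)
    by_cases hjb : j ∈ Set.range b
    · obtain ⟨i', rfl⟩ := hjb
      have : i' ≠ i := fun h => (Finset.mem_erase.1 hj).1 (h ▸ rfl)
      rw [hφi, if_neg this]
      simp
    · exact mul_mem (hout j hjb) (hKS (φ (v j)).2)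
  have h1 := encard_le_of_forall_mem_adjoin hc hS
  have h2 : S.encard ≤ s.card + ((Set.range b)ᶜ).encard :=
    (Set.encard_union_le _ _).trans (by
      rw [Set.encard_coe_eq_coe_finsetCard]
      gcongr
      exact Set.encard_image_le _ _)
  have h3 : (Set.range b).encard = Fintype.card κ := by
    rw [← Set.image_univ, hb.encard_image, Set.encard_univ, ENat.card_eq_coe_fintype_card]
  have h4 : (Set.range b).encard + ((Set.range b)ᶜ).encard = ENat.card J := by
    rw [Set.encard_add_encard_compl, Set.encard_univ]
  have h5 : ((Set.range b)ᶜ).encard ≠ ⊤ := Set.encard_ne_top_iff.2 (Set.toFinite _)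
  rw [← h4, h3] at h1
  have h6 := h1.trans h2
  have h7 := (ENat.add_le_add_iff_right h5).1 h6
  exact_mod_cast h7

/-! ### The span of the monomial curls at a point -/

/-- The value at `x` of the monomial with exponent `N`. -/
def monomialAt {K : Type*} [CommRing K] (x : Fin 3 → K) (N : Fin 3 →₀ ℕ) : K :=
  ∏ i, x i ^ N i

/-- The value at `x` of the exterior derivative of the 1-form `z ^ N dzₖ`. -/
noncomputable def monomialCurl {K : Type*} [CommRing K] (x : Fin 3 → K) (k : Fin 3) (N : Fin 3 →₀ ℕ) :
    Fin 3 → K :=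
  Pi.single (k + 1) (N (k + 2) * monomialAt x (N - Finsupp.single (k + 2) 1)) -
    Pi.single (k + 2) (N (k + 1) * monomialAt x (N - Finsupp.single (k + 1) 1))

lemma map_monomialCurl {K L : Type*} [CommRing K] [CommRing L] (φ : K →+* L) (x : Fin 3 → K)
    (k : Fin 3) (N : Fin 3 →₀ ℕ) (i : Fin 3) :
    φ (monomialCurl x k N i) = monomialCurl (fun i => φ (x i)) k N i := by
  simp only [monomialCurl, monomialAt, Pi.sub_apply, Pi.single_apply, map_sub, apply_ite φ,
    map_zero, map_mul,
    map_natCast, map_prod, map_pow]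

lemma eval_curl_single_monomial (x : Fin 3 → ℂ) (k : Fin 3) (N : Fin 3 →₀ ℕ) (i : Fin 3) :
    eval x (curl (Pi.single k (monomial N 1)) i) = monomialCurl x k N i := by
  have key : ∀ j, eval x (pderiv j (monomial N (1 : ℂ))) =
      N j * monomialAt x (N - Finsupp.single j 1) := fun j => by
    rw [pderiv_monomial, eval_monomial, Finsupp.prod_fintype _ _ (by simp), one_mul, monomialAt]
  simp only [curl, dCoeff, map_sub, monomialCurl, Pi.sub_apply, Pi.single_apply,
    apply_ite (pderiv _),
    map_zero, apply_ite (eval x), key]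
  have e1 : i + 2 = k ↔ i = k + 1 := by clear * -; revert i k; decide
  have e2 : i + 1 = k ↔ i = k + 2 := by clear * -; revert i k; decide
  simp only [e1, e2]
  congr 1
  · split_ifs with h
    · subst h
      rw [show k + 1 + 1 = k + 2 by clear * -; revert k; decide]
    · rfl
  · split_ifs with h
    · subst h
      rw [show k + 2 + 2 = k + 1 by clear * -; revert k; decide]
    · rfl

/-- The pairs `(k, N)` such that the form `z ^ N dzₖ` has degree `d`. -/
def formExponents (a : Fin 3 → ℕ) (d : ℤ) : Set (Fin 3 × (Fin 3 →₀ ℕ)) :=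
  {p | Finsupp.weight (fun j => (a j : ℤ)) p.2 + a p.1 = d}

lemma finite_formExponents {a : Fin 3 → ℕ} (ha : ∀ i, 0 < a i) (d : ℤ) :
    (formExponents a d).Finite := by
  refine (Set.finite_iUnion fun k : Fin 3 =>
    (finite_setOf_weight_eq ha (d - a k)).image (Prod.mk k)).subset fun p hp => ?_
  refine Set.mem_iUnion.2 ⟨p.1, p.2, ?_, rfl⟩
  exact eq_sub_of_add_eq hp

/-- The span of the values at `x` of the exterior derivatives of the forms `z ^ N dzₖ` of degree
`d`. -/
noncomputable def curlSpan {K : Type*} [Field K] (a : Fin 3 → ℕ) (d : ℤ) (x : Fin 3 → K) :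
    Submodule K (Fin 3 → K) :=
  Submodule.span K (Set.range fun p : formExponents a d => monomialCurl x p.1.1 p.1.2)

section Span

variable {K : Type*} [Field K] {a : Fin 3 → ℕ} {ℓ : ℤ} {x : Fin 3 → K}

lemma monomialAt_add_single (m : Fin 3 →₀ ℕ) (i : Fin 3) :
    monomialAt x (m + Finsupp.single i 1) = monomialAt x m * x i := by
  simp only [monomialAt, Finsupp.add_apply, pow_add, Finset.prod_mul_distrib]
  congr 1
  rw [Finset.prod_eq_single i] <;> simp +contextual [eq_comm]

lemma monomialCurl_mem_curlSpan {k : Fin 3} {N : Fin 3 →₀ ℕ}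
    (h : Finsupp.weight (fun j => (a j : ℤ)) N = ℓ + a (k + 1) + a (k + 2)) :
    monomialCurl x k N ∈ curlSpan a (ℓ + ∑ i, (a i : ℤ)) x :=
  Submodule.subset_span ⟨⟨(k, N), by
    simp only [formExponents, Set.mem_ofPred_eq, h, sum_cyclic (fun i => (a i : ℤ)) k]; ring⟩, rfl⟩

lemma single_mem_of_smul_mem {W : Submodule K (Fin 3 → K)} {i : Fin 3} {c : K} (hc : c ≠ 0)
    (h : Pi.single i c ∈ W) : Pi.single i 1 ∈ W := by
  have := W.smul_mem c⁻¹ h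
  rwa [← Pi.single_smul, smul_eq_mul, inv_mul_cancel₀ hc] at this

/-- Comes from the form z^m z_i z_j dz_k, with k the third index, after division by the value of z^m
and up to sign. -/
lemma sub_mem_curlSpan {i j : Fin 3} (hij : i ≠ j) {m : Fin 3 →₀ ℕ}
    (hm : Finsupp.weight (fun j => (a j : ℤ)) m = ℓ) (hx : monomialAt x m ≠ 0) :
    (Pi.single i ((m j + 1) * x i) - Pi.single j ((m i + 1) * x j) : Fin 3 → K) ∈
      curlSpan a (ℓ + ∑ i, (a i : ℤ)) x := by
  have key : ∀ k : Fin 3, (Pi.single (k + 1) ((m (k + 2) + 1) * x (k + 1)) -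
      Pi.single (k + 2) ((m (k + 1) + 1) * x (k + 2)) : Fin 3 → K) ∈
        curlSpan a (ℓ + ∑ i, (a i : ℤ)) x := by
    intro k
    have hne : k + 1 ≠ k + 2 := by clear * -; revert k; decide
    have h1 := monomialCurl_mem_curlSpan (x := x) (a := a) (ℓ := ℓ) (k := k)
      (N := m + Finsupp.single (k + 1) 1 + Finsupp.single (k + 2) 1) (by
        rw [map_add, map_add, hm, Finsupp.weight_single, one_smul, Finsupp.weight_single, one_smul])
    have h2 := (curlSpan a (ℓ + ∑ i, (a i : ℤ)) x).smul_mem (monomialAt x m)⁻¹ h1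
    convert h2 using 1
    rw [monomialCurl, add_tsub_cancel_right, add_right_comm, add_tsub_cancel_right,
      monomialAt_add_single, monomialAt_add_single, smul_sub, ← Pi.single_smul, ← Pi.single_smul]
    simp only [Finsupp.add_apply, Finsupp.single_eq_same, Finsupp.single_eq_of_ne hne,
      Finsupp.single_eq_of_ne hne.symm, smul_eq_mul, add_zero]
    push_cast
    congr 2 <;> field_simp
  obtain h | ⟨k, rfl, rfl⟩ | ⟨k, rfl, rfl⟩ :
      i = j ∨ (∃ k, i = k + 1 ∧ j = k + 2) ∨ ∃ k, j = k + 1 ∧ i = k + 2 := by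
    clear * -; revert i j; decide
  · exact absurd h hij
  · exact key k
  · rw [← neg_sub]
    exact neg_mem (key k)

lemma monomialAt_single_ne_zero {i : Fin 3} (hi : x i ≠ 0) (n : ℕ) :
    monomialAt x (Finsupp.single i n) ≠ 0 := by
  refine Finset.prod_ne_zero_iff.2 fun j _ => ?_
  by_cases h : j = i
  · subst h; exact pow_ne_zero _ hi
  · simp [Finsupp.single_eq_of_ne h]

lemma exists_weight_single_eq (ha : ∀ i, 0 < a i) (hℓ : 0 ≤ ℓ) {i : Fin 3} (h : (a i : ℤ) ∣ ℓ) :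
    ∃ n : ℕ, (n : ℤ) * a i = ℓ := by
  obtain ⟨n, hn⟩ := h
  have hai : (0 : ℤ) < a i := by exact_mod_cast ha i
  have hn0 : 0 ≤ n := by
    have : 0 ≤ (a i : ℤ) * n := by rw [← hn]; positivity
    exact nonneg_of_mul_nonneg_right this hai
  lift n to ℕ using hn0
  exact ⟨n, by rw [hn]; ring⟩

variable [CharZero K]

/-- As z^n does not involve z_i, the field z^n ∂_i has no divergence: up to a positive integer it is
the curl of z^n z_{i+1} dz_{i+2}. -/
lemma single_mem_curlSpan {i : Fin 3} {n : Fin 3 →₀ ℕ} (hi : n i = 0)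
    (hn : Finsupp.weight (fun j => (a j : ℤ)) n = ℓ + a i) (hx : monomialAt x n ≠ 0) :
    Pi.single i 1 ∈ curlSpan a (ℓ + ∑ i, (a i : ℤ)) x := by
  have e1 : i + 2 + 1 = i := by clear * -; revert i; decide
  have e2 : i + 2 + 2 = i + 1 := by clear * -; revert i; decide
  have h1 := monomialCurl_mem_curlSpan (x := x) (a := a) (ℓ := ℓ) (k := i + 2)
    (N := n + Finsupp.single (i + 1) 1) (by
      rw [e1, e2, map_add, hn, Finsupp.weight_single, one_smul])
  rw [monomialCurl, e1, e2] at h1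
  have hne : i + 1 ≠ i := by clear * -; revert i; decide
  simp only [Finsupp.add_apply, Finsupp.single_eq_same, hi, Finsupp.single_eq_of_ne hne.symm,
    add_tsub_cancel_right] at h1
  simp only [add_zero, Nat.cast_zero, zero_mul, Pi.single_zero, sub_zero] at h1
  refine single_mem_of_smul_mem (mul_ne_zero (Nat.cast_ne_zero.2 (Nat.succ_ne_zero _)) hx) h1

lemma single_mem_of_eq_zero {i k : Fin 3} (hik : i ≠ k) {m : Fin 3 →₀ ℕ}
    (hm : Finsupp.weight (fun j => (a j : ℤ)) m = ℓ) (hx : monomialAt x m ≠ 0) (hk : x k = 0)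
    (hi : x i ≠ 0) : Pi.single i 1 ∈ curlSpan a (ℓ + ∑ i, (a i : ℤ)) x := by
  have h := sub_mem_curlSpan hik hm hx
  rw [hk, mul_zero, Pi.single_zero, sub_zero] at h
  refine single_mem_of_smul_mem (mul_ne_zero (Nat.cast_add_one_ne_zero _) hi) h

lemma single_mem_of_single_mem {i j : Fin 3} (hij : i ≠ j) {m : Fin 3 →₀ ℕ}
    (hm : Finsupp.weight (fun j => (a j : ℤ)) m = ℓ) (hx : monomialAt x m ≠ 0) (hi : x i ≠ 0)
    (hj : Pi.single j 1 ∈ curlSpan a (ℓ + ∑ i, (a i : ℤ)) x) :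
    Pi.single i 1 ∈ curlSpan a (ℓ + ∑ i, (a i : ℤ)) x := by
  have h := sub_mem_curlSpan hij hm hx
  have h1 := Submodule.smul_mem _ (((m i : K) + 1) * x j) hj
  rw [← Pi.single_smul, smul_eq_mul, mul_one] at h1
  have h2 := add_mem h h1
  rw [sub_add_cancel] at h2
  refine single_mem_of_smul_mem (mul_ne_zero (Nat.cast_add_one_ne_zero _) hi) h2

lemma single_mem_of_dvd (ha : ∀ i, 0 < a i) (hℓ : 0 ≤ ℓ) {i j : Fin 3} (hij : i ≠ j)
    (h : (a i : ℤ) ∣ ℓ + a j) (hi : x i ≠ 0) :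
    Pi.single j 1 ∈ curlSpan a (ℓ + ∑ i, (a i : ℤ)) x := by
  obtain ⟨n, hn⟩ := h
  have hai : (0 : ℤ) < a i := by exact_mod_cast ha i
  have hn0 : 0 ≤ n := by
    have : 0 ≤ (a i : ℤ) * n := by rw [← hn]; positivity
    exact nonneg_of_mul_nonneg_right this hai
  lift n to ℕ using hn0
  refine single_mem_curlSpan (n := Finsupp.single i n) (Finsupp.single_eq_of_ne hij.symm) ?_
    (monomialAt_single_ne_zero hi n)
  rw [Finsupp.weight_single, hn]
  simp [mul_comm]

end Span

/-- The congruence ℓ + a_i ≡ 0 modulo a_i itself amounts to a_i ∣ ℓ. -/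
lemma Admissible.dvd_or {a : Fin 3 → ℕ} {ℓ : ℤ} (h : Admissible a ℓ) {i j k : Fin 3}
    (hij : i ≠ j) (hik : i ≠ k) (hjk : j ≠ k) :
    (a i : ℤ) ∣ ℓ ∨ (a i : ℤ) ∣ ℓ + a j ∨ (a i : ℤ) ∣ ℓ + a k := by
  have key : ∀ m, ℓ + a m ≡ 0 [ZMOD a i] → m = i ∨ m = j ∨ m = k →
      (a i : ℤ) ∣ ℓ ∨ (a i : ℤ) ∣ ℓ + a j ∨ (a i : ℤ) ∣ ℓ + a k := by
    rintro m hm (rfl | rfl | rfl)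
    · exact Or.inl (dvd_add_self_right.1 (Int.modEq_zero_iff_dvd.1 hm))
    · exact Or.inr (Or.inl (Int.modEq_zero_iff_dvd.1 hm))
    · exact Or.inr (Or.inr (Int.modEq_zero_iff_dvd.1 hm))
  have hm : ∀ m, m = i ∨ m = j ∨ m = k := by
    clear * - hij hik hjk
    revert i j k; decide
  rcases h i with h | h | h
  exacts [key 0 h (hm 0), key 1 h (hm 1), key 2 h (hm 2)]

section Span

variable {K : Type*} [Field K] [CharZero K] {a : Fin 3 → ℕ} {ℓ : ℤ} {x : Fin 3 → K}

lemma exists_single_mem_of_vertex (ha : IsWeights a) (hℓ : 0 < ℓ) (hadm : Admissible a ℓ)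
    {i j k : Fin 3} (hij : i ≠ j) (hik : i ≠ k) (hjk : j ≠ k) (hi : x i ≠ 0) (hj : x j = 0) :
    ∃ s, Pi.single s 1 ∈ curlSpan a (ℓ + ∑ i, (a i : ℤ)) x := by
  rcases hadm.dvd_or hij hik hjk with h | h | h
  · obtain ⟨n, hn⟩ := exists_weight_single_eq ha.1 hℓ.le h
    exact ⟨i, single_mem_of_eq_zero hij (m := Finsupp.single i n)
      (by rw [Finsupp.weight_single, ← hn]; simp) (monomialAt_single_ne_zero hi n) hj hi⟩
  · exact ⟨j, single_mem_of_dvd ha.1 hℓ.le hij h hi⟩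
  · exact ⟨k, single_mem_of_dvd ha.1 hℓ.le hik h hi⟩

/-- If ℓ lies in the semigroup of a_i and a_j, a monomial of degree ℓ is nonzero at x, and x_k = 0
yields both e_i and e_j. Otherwise the divisibilities at i and j each give a coordinate vector.
These coincide only when both are e_k, and then `exists_add_mul_eq_of_dvd`, with admissibility at k,
puts ℓ in the semigroup. -/
lemma exists_single_mem_of_edge (ha : IsWeights a) (hℓ : 0 < ℓ) (hadm : Admissible a ℓ)
    {i j k : Fin 3} (hij : i ≠ j) (hik : i ≠ k) (hjk : j ≠ k) (hi : x i ≠ 0) (hj : x j ≠ 0)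
    (hk : x k = 0) :
    ∃ s t, s ≠ t ∧ Pi.single s 1 ∈ curlSpan a (ℓ + ∑ i, (a i : ℤ)) x ∧
      Pi.single t 1 ∈ curlSpan a (ℓ + ∑ i, (a i : ℤ)) x := by
  have key : (∃ u v : ℕ, (u : ℤ) * a i + v * a j = ℓ) →
      ∃ s t, s ≠ t ∧ Pi.single s 1 ∈ curlSpan a (ℓ + ∑ i, (a i : ℤ)) x ∧
        Pi.single t 1 ∈ curlSpan a (ℓ + ∑ i, (a i : ℤ)) x := by
    rintro ⟨u, v, huv⟩
    have hm : Finsupp.weight (fun j => (a j : ℤ)) (Finsupp.single i u + Finsupp.single j v) = ℓ := by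
      rw [map_add, Finsupp.weight_single, Finsupp.weight_single, ← huv]
      simp
    have hx : monomialAt x (Finsupp.single i u + Finsupp.single j v) ≠ 0 := by
      have : monomialAt x (Finsupp.single i u + Finsupp.single j v) =
          monomialAt x (Finsupp.single i u) * monomialAt x (Finsupp.single j v) := by
        simp [monomialAt, pow_add, Finset.prod_mul_distrib]
      rw [this]
      exact mul_ne_zero (monomialAt_single_ne_zero hi u) (monomialAt_single_ne_zero hj v)
    exact ⟨i, j, hij, single_mem_of_eq_zero hik hm hx hk hi, single_mem_of_eq_zero hjk hm hx hk hj⟩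
  rcases hadm.dvd_or hij hik hjk with h1 | h1 | h1
  · obtain ⟨n, hn⟩ := exists_weight_single_eq ha.1 hℓ.le h1
    exact key ⟨n, 0, by simpa using hn⟩
  all_goals
    rcases hadm.dvd_or hij.symm hjk hik with h2 | h2 | h2
    · obtain ⟨n, hn⟩ := exists_weight_single_eq ha.1 hℓ.le h2
      exact key ⟨0, n, by simpa using hn⟩
  · exact ⟨j, i, hij.symm, single_mem_of_dvd ha.1 hℓ.le hij h1 hi,
      single_mem_of_dvd ha.1 hℓ.le hij.symm h2 hj⟩
  · exact ⟨j, k, hjk, single_mem_of_dvd ha.1 hℓ.le hij h1 hi,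
      single_mem_of_dvd ha.1 hℓ.le hjk h2 hj⟩
  · exact ⟨k, i, hik.symm, single_mem_of_dvd ha.1 hℓ.le hik h1 hi,
      single_mem_of_dvd ha.1 hℓ.le hij.symm h2 hj⟩
  · refine key (exists_add_mul_eq_of_dvd (ha.1 i) (ha.1 j) (ha.1 k) (ha.2 hij) (ha.2 hik.symm)
      (ha.2 hjk.symm) hℓ h1 h2 ?_)
    have := hadm.dvd_or hik.symm hjk.symm hij
    tauto

/-- If some monomial has degree ℓ, one coordinate vector in the span produces the others. If none
has, either a divisibility gives e_k directly, or the three divisibilities put ℓ in the semigroup of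
two weights, a contradiction. -/
lemma single_mem_of_torus (ha : IsWeights a) (hℓ : 0 < ℓ) (hadm : Admissible a ℓ)
    (hx : ∀ i, x i ≠ 0) (k : Fin 3) :
    Pi.single k 1 ∈ curlSpan a (ℓ + ∑ i, (a i : ℤ)) x := by
  have hmon : ∀ m, monomialAt x m ≠ 0 := fun m =>
    Finset.prod_ne_zero_iff.2 fun i _ => pow_ne_zero _ (hx i)
  by_cases hS : ∃ m : Fin 3 →₀ ℕ, Finsupp.weight (fun j => (a j : ℤ)) m = ℓ
  · obtain ⟨m, hm⟩ := hS
    have key : ∀ j, Pi.single j 1 ∈ curlSpan a (ℓ + ∑ i, (a i : ℤ)) x →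
        Pi.single k 1 ∈ curlSpan a (ℓ + ∑ i, (a i : ℤ)) x := by
      intro j hj
      by_cases hkj : k = j
      · rwa [hkj]
      · exact single_mem_of_single_mem hkj hm (hmon m) (hx k) hj
    by_cases hij : ∃ i j, i ≠ j ∧ (a i : ℤ) ∣ ℓ + a j
    · obtain ⟨i, j, hij, h⟩ := hij
      exact key j (single_mem_of_dvd ha.1 hℓ.le hij h (hx i))
    · push Not at hij
      have hdvd : ∀ i j k : Fin 3, i ≠ j → i ≠ k → j ≠ k → (a i : ℤ) ∣ ℓ := fun i j k h1 h2 h3 =>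
        (hadm.dvd_or h1 h2 h3).resolve_right fun h => h.elim (hij i j h1) (hij i k h2)
      have h01 : (0 : Fin 3) ≠ 1 := by decide
      obtain ⟨n, hn⟩ := exists_weight_single_eq ha.1 hℓ.le (hdvd 0 1 2 h01 (by decide) (by decide))
      obtain ⟨p, hp⟩ := exists_weight_single_eq ha.1 hℓ.le
        (hdvd 1 0 2 h01.symm (by decide) (by decide))
      have h1 := sub_mem_curlSpan (a := a) (ℓ := ℓ) (x := x) h01 (m := Finsupp.single 0 n)
        (by rw [Finsupp.weight_single, ← hn]; simp) (hmon _)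
      have h2 := sub_mem_curlSpan (a := a) (ℓ := ℓ) (x := x) h01 (m := Finsupp.single 1 p)
        (by rw [Finsupp.weight_single, ← hp]; simp) (hmon _)
      -- All weights divide `ℓ`, and the powers of z_0 and z_1 of degree `ℓ` give two relations
      -- between e_0 and e_1. Eliminating e_1 leaves the factor `(n + 1) * (p + 1) - 1`, nonzero as
      -- `n > 0`.
      have h3 := sub_mem (Submodule.smul_mem _ ((n : K) + 1) h2) h1
      simp only [Finsupp.single_eq_same, Finsupp.single_eq_of_ne h01,
        Finsupp.single_eq_of_ne h01.symm,
        smul_sub, ← Pi.single_smul, smul_eq_mul, Nat.cast_zero, zero_add, one_mul] at h3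
      rw [sub_sub_sub_cancel_right, ← Pi.single_sub, ← mul_assoc, ← sub_one_mul] at h3
      refine key 0 (single_mem_of_smul_mem (mul_ne_zero ?_ (hx 0)) h3)
      have hn0 : 0 < n := by
        by_contra h0
        have : n = 0 := by lia
        simp [this] at hn
        lia
      have : ((n : K) + 1) * (p + 1) - 1 = ((n * p + n + p : ℕ) : K) := by push_cast; ring
      rw [this]
      exact Nat.cast_ne_zero.2 (by lia)
  · push Not at hS
    have hnd : ∀ i, ¬ (a i : ℤ) ∣ ℓ := by
      intro i h
      obtain ⟨n, hn⟩ := exists_weight_single_eq ha.1 hℓ.le h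
      exact hS (Finsupp.single i n) (by rw [Finsupp.weight_single, ← hn]; simp)
    obtain ⟨i, j, hij, hik, hjk⟩ : ∃ i j : Fin 3, i ≠ j ∧ i ≠ k ∧ j ≠ k := by
      clear * -; revert k; decide
    have hno : ∀ i j, i ≠ j → ¬ ∃ u v : ℕ, (u : ℤ) * a i + v * a j = ℓ := by
      rintro i j hij ⟨u, v, huv⟩
      refine hS (Finsupp.single i u + Finsupp.single j v) ?_
      rw [map_add, Finsupp.weight_single, Finsupp.weight_single, ← huv]
      simp
    rcases (hadm.dvd_or hij hik hjk).resolve_left (hnd i) with h1 | h1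
    swap
    · exact single_mem_of_dvd ha.1 hℓ.le hik h1 (hx i)
    rcases (hadm.dvd_or hij.symm hjk hik).resolve_left (hnd j) with h2 | h2
    swap
    · exact single_mem_of_dvd ha.1 hℓ.le hjk h2 (hx j)
    exfalso
    rcases (hadm.dvd_or hik.symm hjk.symm hij).resolve_left (hnd k) with h3 | h3
    · exact hno j k hjk (exists_add_mul_eq_of_dvd_add (ha.1 j) (ha.1 k) (ha.2 hjk) (ha.2 hij) hℓ
        h2 h3 h1)
    · exact hno i k hik (exists_add_mul_eq_of_dvd_add (ha.1 i) (ha.1 k) (ha.2 hik) (ha.2 hij.symm)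
        hℓ h1 h3 h2)

end Span

lemma card_le_finrank_of_single_mem {K : Type*} [Field K] {W : Submodule K (Fin 3 → K)}
    {s : Finset (Fin 3)} (h : ∀ k ∈ s, Pi.single k 1 ∈ W) : s.card ≤ Module.finrank K W := by
  have hli : LinearIndependent K fun k : s => (Pi.single k.1 1 : Fin 3 → K) := by
    have := (Pi.basisFun K (Fin 3)).linearIndependent.comp (fun k : s => k.1)
      Subtype.val_injective
    convert this using 2
    simp
  have h1 := finrank_span_eq_card hli
  rw [Fintype.card_coe] at h1
  rw [← h1]
  refine Submodule.finrank_mono (Submodule.span_le.2 ?_)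
  rintro _ ⟨k, rfl⟩
  exact h k.1 k.2

/-- At a point with `r` nonzero coordinates the exterior derivatives of the forms of a positive
admissible degree span a space of dimension at least `r`. -/
lemma card_support_le_finrank {K : Type*} [Field K] [CharZero K] {a : Fin 3 → ℕ}
    (ha : IsWeights a) {ℓ : ℤ} (hℓ : 0 < ℓ) (hadm : Admissible a ℓ) (x : Fin 3 → K)
    {s : Finset (Fin 3)} (hs : ∀ i, i ∈ s ↔ x i ≠ 0) :
    s.card ≤ Module.finrank K (curlSpan a (ℓ + ∑ i, (a i : ℤ)) x) := by
  have hc : s.card ≤ 3 := (Finset.card_le_univ s).trans_eq (by simp)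
  obtain h | h | h | h : s.card = 0 ∨ s.card = 1 ∨ s.card = 2 ∨ s.card = 3 := by lia
  · lia
  · obtain ⟨i, rfl⟩ := Finset.card_eq_one.1 h
    obtain ⟨j, k, hij, hik, hjk⟩ : ∃ j k : Fin 3, i ≠ j ∧ i ≠ k ∧ j ≠ k := by
      clear * -; revert i; decide
    obtain ⟨t, ht⟩ := exists_single_mem_of_vertex (x := x) ha hℓ hadm hij hik hjk
      ((hs i).1 (by simp)) (by by_contra h; simpa [hij.symm] using (hs j).2 h)
    have := card_le_finrank_of_single_mem (s := {t}) (by simpa using ht)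
    simpa using this
  · obtain ⟨i, j, hij, rfl⟩ := Finset.card_eq_two.1 h
    obtain ⟨k, hik, hjk⟩ : ∃ k : Fin 3, i ≠ k ∧ j ≠ k := by
      clear * -; revert i j; decide
    obtain ⟨t, u, htu, ht, hu⟩ := exists_single_mem_of_edge (x := x) ha hℓ hadm hij hik hjk
      ((hs i).1 (by simp)) ((hs j).1 (by simp))
      (by by_contra h; simpa [hik.symm, hjk.symm] using (hs k).2 h)
    have := card_le_finrank_of_single_mem (s := {t, u})
      (W := curlSpan a (ℓ + ∑ i, (a i : ℤ)) x) (by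
        intro v hv
        rcases Finset.mem_insert.1 hv with rfl | hv
        · exact ht
        · rw [Finset.mem_singleton.1 hv]; exact hu)
    rwa [Finset.card_pair htu, ← h] at this
  · have hu : s = Finset.univ := (Finset.card_eq_iff_eq_univ s).1 (by simpa using h)
    exact card_le_finrank_of_single_mem fun k _ =>
      single_mem_of_torus ha hℓ hadm (fun i => (hs i).1 (hu ▸ Finset.mem_univ i)) k

/-! ### Existence of a good form -/

lemma eval_rescale {a : Fin 3 → ℕ} {D : ℤ} {p : MvPolynomial (Fin 3) ℂ}
    (hp : p.IsWeightedHomogeneous (fun j => (a j : ℤ)) D) {t : ℂ} (ht : t ≠ 0) (z : Fin 3 → ℂ) :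
    eval (fun i => t ^ a i * z i) p = t ^ D * eval z p := by
  rw [eval_eq', eval_eq', Finset.mul_sum]
  refine Finset.sum_congr rfl fun m hm => ?_
  have h := hp (mem_support_iff.1 hm)
  rw [weight_intCast] at h
  have h1 : ∏ i, (t ^ a i) ^ m i = t ^ D := by
    rw [← h, Fin.prod_univ_three, Fin.sum_univ_three, zpow_add₀ ht, zpow_add₀ ht]
    simp only [← zpow_natCast, ← zpow_mul]
    simp only [mul_comm]
  simp_rw [mul_pow, Finset.prod_mul_distrib]
  rw [h1]
  ring

/-- The generic form of positive admissible degree has an exterior derivative vanishing only at the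
origin. -/
lemma exists_curl_ne_zero_of_pos {a : Fin 3 → ℕ} (ha : IsWeights a) {ℓ : ℤ} (hℓ : 0 < ℓ)
    (hadm : Admissible a ℓ) :
    ∃ B : OneForm, (∀ i, (B i).IsWeightedHomogeneous (fun j => (a j : ℤ))
      (ℓ + ∑ i, (a i : ℤ) - a i)) ∧ ∀ z : Fin 3 → ℂ, (∀ k, eval z (curl B k) = 0) → z = 0 := by
  classical
  set d := ℓ + ∑ i, (a i : ℤ) with hd
  have hfin := finite_formExponents ha.1 d
  have := hfin.fintype
  obtain ⟨c, hc⟩ := exists_algebraicIndependent (formExponents a d)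
  let B : OneForm := ∑ p, c p • (Pi.single p.1.1 (monomial p.1.2 1) : OneForm)
  have hB : ∀ i, (B i).IsWeightedHomogeneous (fun j => (a j : ℤ)) (d - a i) := by
    intro i
    simp only [B, Finset.sum_apply, Pi.smul_apply]
    refine IsWeightedHomogeneous.sum _ _ _ fun p _ => ?_
    rw [smul_eq_C_mul]
    apply IsWeightedHomogeneous.C_mul
    by_cases hi : i = p.1.1
    · subst hi
      rw [Pi.single_eq_same]
      exact isWeightedHomogeneous_monomial _ _ _ (eq_sub_of_add_eq p.2)
    · rw [Pi.single_eq_of_ne hi]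
      exact isWeightedHomogeneous_zero _ _ _
  have hcurl : ∀ z k, eval z (curl B k) = ∑ p, c p * monomialCurl z p.1.1 p.1.2 k := by
    intro z k
    rw [← curlₗ_apply]
    simp only [B, map_sum, map_smul, Finset.sum_apply, Pi.smul_apply, curlₗ_apply, smul_eval,
      eval_curl_single_monomial]
  refine ⟨B, hB, fun z hz => ?_⟩
  by_contra hz0
  obtain ⟨i₀, hi₀⟩ := Function.ne_iff.1 hz0
  -- The weighted action normalises one nonzero coordinate to 1, which saves one generator of the
  -- field of coordinates: this is the strict inequality that ends the proof.
  obtain ⟨t, ht⟩ := IsAlgClosed.exists_pow_nat_eq (z i₀)⁻¹ (ha.1 i₀)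
  have ht0 : t ≠ 0 := by
    rintro rfl
    rw [zero_pow (ha.1 i₀).ne', eq_comm, inv_eq_zero] at ht
    exact hi₀ ht
  let y : Fin 3 → ℂ := fun i => t ^ a i * z i
  have hy0 : y i₀ = 1 := by
    simp only [y, ht]
    exact inv_mul_cancel₀ hi₀
  have hy : ∀ k, eval y (curl B k) = 0 := fun k => by
    rw [eval_rescale (isWeightedHomogeneous_curl hB k) ht0, hz k, mul_zero]
  let I : Finset (Fin 3) := Finset.univ.filter fun i => y i ≠ 0
  have hI : i₀ ∈ I := by simp [I, hy0]
  let s : Finset ℂ := (I.erase i₀).image y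
  let L : IntermediateField ℚ ℂ := IntermediateField.adjoin ℚ (s : Set ℂ)
  have hyL : ∀ i, y i ∈ L := by
    intro i
    by_cases h1 : i = i₀
    · rw [h1, hy0]; exact one_mem _
    by_cases h2 : y i = 0
    · rw [h2]; exact zero_mem _
    · exact IntermediateField.subset_adjoin _ _
        (Finset.mem_coe.2 (Finset.mem_image_of_mem _ (by simp [I, h1, h2])))
  let x : Fin 3 → L := fun i => ⟨y i, hyL i⟩
  have h1 := finrank_span_le hc (K := L) rfl (fun p => monomialCurl x p.1.1 p.1.2) (by
    intro k
    rw [← hy k, hcurl]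
    refine Finset.sum_congr rfl fun p _ => ?_
    congr 1
    exact map_monomialCurl (algebraMap L ℂ) x _ _ _)
  have h2 := card_support_le_finrank ha hℓ hadm x (s := I) fun i => by
    simp [I, x, ← Subtype.coe_inj]
  have h3 : s.card ≤ (I.erase i₀).card := Finset.card_image_le
  rw [Finset.card_erase_of_mem hI] at h3
  have h4 : 0 < I.card := Finset.card_pos.2 ⟨_, hI⟩
  have h5 := h2.trans h1
  lia

/-- An admissible degree of nonzero forms contains a form whose exterior derivative vanishes only
at the origin. -/
lemma exists_form_of_admissible {a : Fin 3 → ℕ} (ha : IsWeights a) {ℓ : ℤ}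
    (hne : zariskiOneForms a (ℓ + ∑ i, (a i : ℤ)) ≠ ⊥) (hadm : Admissible a ℓ) :
    ∃ A ∈ zariskiOneForms a (ℓ + ∑ i, (a i : ℤ)),
      (∀ z : Fin 3 → ℂ, (∀ k, eval z (curl A k) = 0) → z = 0) ∧
        (ℓ = 0 → radialDiscr (fun i => ((a i : ℂ))⁻¹) (linearPart A) ≠ 0) := by
  obtain ⟨A₁, hA₁, hA₁0⟩ := (Submodule.ne_bot_iff _).1 hne
  have hd : ((ℓ + ∑ i, (a i : ℤ) : ℤ) : ℂ) ≠ 0 := by exact_mod_cast (degree_pos ha hA₁ hA₁0).ne'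
  have key : (∃ B : OneForm, (∀ i, (B i).IsWeightedHomogeneous (fun j => (a j : ℤ))
      (ℓ + ∑ i, (a i : ℤ) - a i)) ∧ ∀ z : Fin 3 → ℂ, (∀ k, eval z (curl B k) = 0) → z = 0) →
      ∃ A ∈ zariskiOneForms a (ℓ + ∑ i, (a i : ℤ)),
        ∀ z : Fin 3 → ℂ, (∀ k, eval z (curl A k) = 0) → z = 0 := by
    rintro ⟨B, hB, hB0⟩
    obtain ⟨A, hA, hAB⟩ := exists_curl_eq_mul hB
    refine ⟨A, hA, fun z hz => hB0 z fun k => ?_⟩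
    have := hz k
    rw [hAB, map_mul, eval_C] at this
    exact (mul_eq_zero.1 this).resolve_left hd
  rcases lt_trichotomy ℓ 0 with hℓ | rfl | hℓ
  · obtain ⟨k, hk⟩ := exists_eq_neg_of_admissible ha hℓ hne hadm
    obtain ⟨A, hA, h⟩ := key (exists_curl_ne_zero_of_eq_neg hk)
    exact ⟨A, hA, h, fun h0 => absurd h0 hℓ.ne⟩
  · have ha' : ∀ i, (0 : ℝ) < a i := fun i => by exact_mod_cast ha.1 i
    -- The curl is d·diag(a_0, 2a_1, -(a_0 + 2a_1)) for the resulting `A`. On diagonal matrices the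
    -- discriminant is the Vandermonde product of the entries divided by the weights, here d times
    -- 1, 2 and a negative number, so distinct.
    obtain ⟨B, hB, hBc⟩ := exists_curl_eq_diagonal a ![a 0 + 2 * a 1, 0, a 0]
    obtain ⟨A, hA, hAB⟩ := exists_curl_eq_mul hB
    set d : ℂ := ((0 + ∑ i, (a i : ℤ) : ℤ) : ℂ)
    let c : Fin 3 → ℂ := ![a 0, 2 * a 1, -(a 0 + 2 * a 1)]
    have hc : ∀ k, curl A k = C (d * c k) * X k := by
      intro k
      rw [hAB, hBc, ← mul_assoc, ← C_mul]
      congr 3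
      fin_cases k <;> simp [c]
    have hac : ∀ i, (a i : ℂ) ≠ 0 := fun i => by exact_mod_cast (ha.1 i).ne'
    have hsum : (a 0 + 2 * a 1 : ℂ) ≠ 0 := by
      have := ha.1 0
      exact_mod_cast (by positivity : a 0 + 2 * a 1 ≠ 0)
    have hc0 : ∀ k, c k ≠ 0 := by
      intro k
      fin_cases k
      · exact hac 0
      · exact mul_ne_zero two_ne_zero (hac 1)
      · exact neg_ne_zero.2 hsum
    refine ⟨A, hA, fun z hz => ?_, fun _ => ?_⟩
    · ext k
      have := hz k
      rw [hc, map_mul, eval_C, eval_X] at this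
      exact (mul_eq_zero.1 this).resolve_left (mul_ne_zero hd (hc0 k))
    · have hM : linearPart A = fun i j => if i = j then d * c i else 0 := by
        ext i j
        rw [linearPart, hc]
        by_cases hij : i = j
        · subst hij; simp
        · simp [hij]
      have e1 : (a 0 + 2 * a 1 + a 2 : ℂ) ≠ 0 := by
        have := ha.1 0
        exact_mod_cast (by positivity : a 0 + 2 * a 1 + a 2 ≠ 0)
      have e2 : (a 0 + 2 * a 1 + 2 * a 2 : ℂ) ≠ 0 := by
        have := ha.1 0
        exact_mod_cast (by positivity : a 0 + 2 * a 1 + 2 * a 2 ≠ 0)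
      have h0 := hac 0
      have h1 := hac 1
      have h2 := hac 2
      have : radialDiscr (fun i => ((a i : ℂ))⁻¹) (linearPart A) * (a 2) ^ 2 =
          -(d ^ 3 * (a 0 + 2 * a 1 + a 2) * (a 0 + 2 * a 1 + 2 * a 2)) := by
        rw [hM]
        simp [radialDiscr, c]
        field_simp
        ring
      intro h
      rw [h, zero_mul, eq_comm, neg_eq_zero] at this
      exact mul_ne_zero (mul_ne_zero (pow_ne_zero 3 hd) e1) e2 this
  · obtain ⟨A, hA, h⟩ := key (exists_curl_ne_zero_of_pos ha hℓ hadm)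
    exact ⟨A, hA, h, fun h0 => absurd h0 hℓ.ne'⟩

end WeightedPlane

open WeightedPlane in
theorem theorem5p14 (a : Fin 3 → ℕ) (ha : IsWeights a) (ℓ : ℤ)
    (hne : zariskiOneForms a (ℓ + ∑ i, (a i : ℤ)) ≠ ⊥) :
    (∃ U : Set (zariskiOneForms a (ℓ + ∑ i, (a i : ℤ))),
      IsZariskiOpen U ∧ U.Nonempty ∧
        ∀ α ∈ U, IsFoliation α.1 ∧ ∀ x ∈ singularSet a α.1, IsKupkaPoint a α.1 x) ↔
      Admissible a ℓ := by
  obtain ⟨A₁, hA₁, hA₁0⟩ := (Submodule.ne_bot_iff _).1 hne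
  have hd := (degree_pos ha hA₁ hA₁0).ne'
  constructor
  · rintro ⟨U, -, ⟨α, hα⟩, hU⟩
    exact admissible_of_kupka hd α.2 (hU α hα).2
  · intro hadm
    obtain ⟨A, hA, h, h0⟩ := exists_form_of_admissible ha hne hadm
    exact exists_zariski_open ha hd hA h h0
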